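/- **Setting.** Let $\Phi\colon\mathbb R^2\to\mathbb R^2$ be a $C^1$ diffeomorphism with an affine three-legged horseshoe in $[0,1]^2$: there are pairwise disjoint non-degenerate compact intervals $I_0,I_1,I_2\subset[0,1]$ such that on each leg $\widehat{\mathbf C}_i=[0,1]\times I_i$ one has $\Phi(x^s,x^u)=(a_ix^s+b_i,\;c_ix^u+d_i)$, where $x^s\mapsto a_ix^s+b_i$ maps $[0,1]$ into $[0,1]$ and $x^u\mapsto c_ix^u+d_i$ maps $I_i$ onto $[0,1]$. Let $f_0,f_1,f_2\colon[0,1]\to[0,1]$ be injective $C^1$ maps (with one-sided derivatives at $0$ and $1$) such that $|a_i|<|f_j'(x)|<|c_i|$ for all $i,j\in\{0,1,2\}$ and $x\in[0,1]$. Put $\mathbf C=[0,1]^3$, $\mathbf C_i=\widehat{\mathbf C}_i\times[0,1]$ and $$F(\widehat x,x)=(\Phi(\widehat x),f_i(x))\quad\text{for }(\widehat x,x)\in\mathbf C_i ,\ i=0,1,2 .$$ Thus $F$ is defined on $\mathbf C_0\cup\mathbf C_1\cup\mathbf C_2\subset\mathbf C$; orbits of $F$ are required to stay in this domain. Assume: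 * (F0) $f_0$ is increasing and has exactly two fixed points, $0$ and $1$, with $\beta_0=f_0'(0)>1$ and $\lambda_0=f_0'(1)\in(0,1)$; and $f_0'\ge\lambda_0$ on $[0,1]$. * (F1) $f_1(x)=\gamma(1-x)$ with $\lambda_0\le\gamma<1$. * (F2) $f_2$ is increasing, $f_2(0)=0$ with $f_2'(0)>1$, and there is $p_2\in(0,1)$ with $f_2(p_2)=p_2$ and $|f_2'(p_2)|<1$. * (F01) $f_0'$ is decreasing (in the weak sense) on $[0,1]$ and $\displaystyle \gamma\,\frac{\lambda_0^3(1-\lambda_0)}{1-\beta_0^{-1}}>1$. Let $\Lambda=\bigcap_{i\in\mathbb Z}F^i(\mathbf C)$ be the maximal invariant set of $F$ in $\mathbf C$. A *saddle of $u$-index two* is a periodic point $Q$ of $F$, of some period $m\ge1$, such that $DF^m(Q)$ has no eigenvalue of modulus one and exactly two eigenvalues (with multiplicity) of modulus greater than one. Its *homoclinic class relative to $\mathbf C$* is the closure of the set of the points of transverse intersection of the stable and unstable manifolds of the orbit of $Q$ whose full orbit is contained in $\mathbf C$. **Proposition.** There is a saddle $Q^*$ of $F$ of $u$-index two such that $\Lambda$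 equals the homoclinic class of $Q^*$ relative to $\mathbf C$. In particular $\Lambda$ is topologically transitive: there is a point $X\in\Lambda$ such that the closure of $\{F^n(X):n\ge0\}$ is $\Lambda$. -/

import Mathlib

open Set Filter Topology

noncomputable section

/-! ### Dynamics of a map `F` defined on a subset `D` of `ℝ³`

Only the values of `F` on `D` matter below. Points of `ℝ³` are written `((xˢ, xᵘ), x)`. -/

/-- Three-dimensional space, with coordinates `((xˢ, xᵘ), x)`. -/
abbrev Space3 : Type := (ℝ × ℝ) × ℝ

/-- The cube `[0,1]³`. -/
def cube3 : Set Space3 := {z | z.1.1 ∈ Icc 0 1 ∧ z.1.2 ∈ Icc 0 1 ∧ z.2 ∈ Icc 0 1}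

/-- `x` is a full orbit of the map `F : D → ℝ³`. -/
def IsFullOrbit (D : Set Space3) (F : Space3 → Space3) (x : ℤ → Space3) : Prop :=
  ∀ n : ℤ, x n ∈ D ∧ F (x n) = x (n + 1)

/-- `p` is a periodic full orbit through `Q`, parametrised so that `p 0 = Q`. -/
def IsPeriodicOrbitOf (D : Set Space3) (F : Space3 → Space3) (p : ℤ → Space3) (Q : Space3) :
    Prop :=
  IsFullOrbit D F p ∧ p 0 = Q ∧ ∃ m : ℕ, 0 < m ∧ ∀ n : ℤ, p (n + m) = p n

/-- The image `F(S)`. -/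
def fwdImage (D : Set Space3) (F : Space3 → Space3) (S : Set Space3) : Set Space3 :=
  F '' (S ∩ D)

/-- The preimage `F⁻¹(S)`. -/
def bwdImage (D : Set Space3) (F : Space3 → Space3) (S : Set Space3) : Set Space3 :=
  D ∩ F ⁻¹' S

/-- The maximal invariant set `⋂_{i ∈ ℤ} Fⁱ(C)` of `F` in `C`. -/
def maximalInvariantSet (D : Set Space3) (F : Space3 → Space3) (C : Set Space3) : Set Space3 :=
  (⋂ n : ℕ, (fwdImage D F)^[n] C) ∩ (⋂ n : ℕ, (bwdImage D F)^[n] C)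

/-- The stable manifold of the orbit of the periodic point `Q`: the points whose forward orbit is
asymptotic to the orbit of some iterate of `Q`. -/
def stableManifold (D : Set Space3) (F : Space3 → Space3) (Q : Space3) : Set Space3 :=
  {X | ∃ p : ℤ → Space3, IsPeriodicOrbitOf D F p Q ∧
    ∃ x : ℕ → Space3, x 0 = X ∧ (∀ n : ℕ, x n ∈ D ∧ F (x n) = x (n + 1)) ∧
      ∃ k : ℤ, Tendsto (fun n : ℕ => dist (x n) (p (k + n))) atTop (𝓝 0)}

/-- The unstable manifold of the orbit of the periodic point `Q`: the points having a backward
orbit that is asymptotic, in backward time, to the orbit of some iterate of `Q`. -/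
def unstableManifold (D : Set Space3) (F : Space3 → Space3) (Q : Space3) : Set Space3 :=
  {X | ∃ p : ℤ → Space3, IsPeriodicOrbitOf D F p Q ∧
    ∃ x : ℕ → Space3, x 0 = X ∧ (∀ n : ℕ, x (n + 1) ∈ D ∧ F (x (n + 1)) = x n) ∧
      ∃ k : ℤ, Tendsto (fun n : ℕ => dist (x n) (p (k - n))) atTop (𝓝 0)}

/-- The tangent space at `X` of a `C¹` immersed submanifold `W`, possibly with boundary or corners:
the span of the initial velocities of the `C¹` curves in `W` that start at `X`. -/
def tangentAt (W : Set Space3) (X : Space3) : Submodule ℝ Space3 :=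
  Submodule.span ℝ {v | ∃ c : ℝ → Space3, ContDiffOn ℝ 1 c (Icc 0 1) ∧ MapsTo c (Icc 0 1) W ∧
    c 0 = X ∧ HasDerivWithinAt c v (Icc 0 1) 0}

/-- The set `V ⋔ W` of transverse intersection points of two submanifolds of `ℝ³`. -/
def transverseIntersection (V W : Set Space3) : Set Space3 :=
  {X | X ∈ V ∧ X ∈ W ∧ tangentAt V X ⊔ tangentAt W X = ⊤}

/-- The homoclinic class of `Q` relative to `C`: the closure of the set of the points in the
transverse intersections of the stable and the unstable manifold of the orbit of `Q` whose
full orbit is contained in `C`. -/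
def relHomoclinicClass (D : Set Space3) (F : Space3 → Space3) (C : Set Space3) (Q : Space3) :
    Set Space3 :=
  closure {X | X ∈ transverseIntersection (stableManifold D F Q) (unstableManifold D F Q) ∧
    ∃ x : ℤ → Space3, IsFullOrbit D F x ∧ x 0 = X ∧ ∀ n : ℤ, x n ∈ C}

/-- The derivative of `Fⁿ` at `X`, as the product of the derivatives of `F` along the orbit. -/
def derivIter (D : Set Space3) (F : Space3 → Space3) : ℕ → Space3 → (Space3 →L[ℝ] Space3)
  | 0, _ => ContinuousLinearMap.id ℝ Space3
  | n + 1, X => (fderivWithin ℝ F D (F^[n] X)).comp (derivIter D F n X)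

/-- The complex eigenvalues of `A`, with algebraic multiplicity. -/
def complexEigenvalues (A : Space3 →L[ℝ] Space3) : Multiset ℂ :=
  (LinearMap.charpoly (A : Space3 →ₗ[ℝ] Space3)).aroots ℂ

open Classical in
/-- `Q` is a saddle of u-index `k`: a periodic point, of some period `m`, such that `DFᵐ(Q)` has no
eigenvalue of modulus one, and has exactly `k` eigenvalues of modulus greater than one, counted
with multiplicity, where `k` is neither `0` nor `3`. -/
def IsSaddle (D : Set Space3) (F : Space3 → Space3) (Q : Space3) (k : ℕ) : Prop :=
  (∀ n : ℕ, F^[n] Q ∈ D) ∧ ∃ m : ℕ, 0 < m ∧ F^[m] Q = Q ∧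
    (∀ μ ∈ complexEigenvalues (derivIter D F m Q), ‖μ‖ ≠ 1) ∧
    (complexEigenvalues (derivIter D F m Q)).countP (fun μ => 1 < ‖μ‖) = k ∧
    0 < k ∧ k < 3

/-- `L` is topologically transitive for `F`: it is the closure of the (forward) orbit of one of its
points. -/
def IsTopologicallyTransitive (F : Space3 → Space3) (L : Set Space3) : Prop :=
  ∃ X ∈ L, closure (range fun n : ℕ => F^[n] X) = L

/-! ### The skew products -/

/-- The data of the skew product: a planar diffeomorphism `Φ` with an affine horseshoe with three
legs in the square `[0,1]²`, and three fibre maps `f 0`, `f 1`, `f 2`. The legs are the strips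
`[0,1] × [lo i, hi i]`, which `Φ` maps affinely onto strips `J i × [0,1]` with `J i ⊆ [0,1]`. -/
structure HorseshoeSkewProduct where
  /-- The planar diffeomorphism. -/
  Φ : (ℝ × ℝ) ≃ (ℝ × ℝ)
  contDiff_Φ : ContDiff ℝ 1 Φ
  contDiff_Φ_symm : ContDiff ℝ 1 Φ.symm
  lo : Fin 3 → ℝ
  hi : Fin 3 → ℝ
  zero_le_lo : ∀ i, 0 ≤ lo i
  lo_lt_hi : ∀ i, lo i < hi i
  hi_le_one : ∀ i, hi i ≤ 1
  disjoint_legs : ∀ i j, i ≠ j → Disjoint (Icc (lo i) (hi i)) (Icc (lo j) (hi j))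
  /-- Linear part and translation part of `Φ` on leg `i`, in the first direction. -/
  a : Fin 3 → ℝ
  b : Fin 3 → ℝ
  /-- Linear part and translation part of `Φ` on leg `i`, in the second direction. -/
  c : Fin 3 → ℝ
  d : Fin 3 → ℝ
  Φ_affine : ∀ i, ∀ s ∈ Icc (0 : ℝ) 1, ∀ u ∈ Icc (lo i) (hi i),
    Φ (s, u) = (a i * s + b i, c i * u + d i)
  maps_s : ∀ i, MapsTo (fun s => a i * s + b i) (Icc 0 1) (Icc 0 1)
  image_u : ∀ i, (fun u => c i * u + d i) '' Icc (lo i) (hi i) = Icc 0 1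
  /-- The fibre maps (only their restrictions to `[0,1]` matter). -/
  f : Fin 3 → ℝ → ℝ
  mapsTo_f : ∀ i, MapsTo (f i) (Icc 0 1) (Icc 0 1)
  contDiffOn_f : ∀ i, ContDiffOn ℝ 1 (f i) (Icc 0 1)
  injOn_f : ∀ i, InjOn (f i) (Icc 0 1)
  /-- The contraction of the horseshoe is stronger than any contraction of the fibre maps. -/
  contraction_dominates : ∀ i j, ∀ x ∈ Icc (0 : ℝ) 1, |a i| < |derivWithin (f j) (Icc 0 1) x|
  /-- The expansion of the horseshoe is stronger than any expansion of the fibre maps. -/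
  expansion_dominates : ∀ i j, ∀ x ∈ Icc (0 : ℝ) 1, |derivWithin (f j) (Icc 0 1) x| < |c i|

namespace HorseshoeSkewProduct

/-- The derivative `f_i'` of the fibre map `f_i : [0,1] → [0,1]` (one-sided at `0` and `1`). -/
def df (S : HorseshoeSkewProduct) (i : Fin 3) (x : ℝ) : ℝ := derivWithin (S.f i) (Icc 0 1) x

/-- The planar sub-cubes (the legs of the horseshoe). -/
def leg (S : HorseshoeSkewProduct) (i : Fin 3) : Set (ℝ × ℝ) := Icc 0 1 ×ˢ Icc (S.lo i) (S.hi i)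

/-- The domain of `F`: the union of the sub-cubes `leg i × [0,1]` of the cube. -/
def domain (S : HorseshoeSkewProduct) : Set Space3 := ⋃ i, S.leg i ×ˢ Icc (0 : ℝ) 1

open Classical in
/-- The skew product `F(x̂, x) = (Φ(x̂), f_i(x))` for `x̂` in leg `i` (see `F_eq`); its values off
`domain` are irrelevant. -/
def F (S : HorseshoeSkewProduct) (z : Space3) : Space3 :=
  (S.Φ z.1, if z.1 ∈ S.leg 0 then S.f 0 z.2 else if z.1 ∈ S.leg 1 then S.f 1 z.2 else S.f 2 z.2)

theorem F_eq (S : HorseshoeSkewProduct) (i : Fin 3) (z : Space3) (hz : z.1 ∈ S.leg i) :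
    S.F z = (S.Φ z.1, S.f i z.2) := by
  have key : ∀ j, j ≠ i → z.1 ∉ S.leg j := fun j hj h =>
    Set.disjoint_left.mp (S.disjoint_legs j i hj) h.2 hz.2
  unfold F
  fin_cases i
  · have h0 : z.1 ∈ S.leg 0 := hz
    simp [h0]
  · have h1 : z.1 ∈ S.leg 1 := hz
    simp [h1, key 0 (by decide)]
  · simp [key 0 (by decide), key 1 (by decide)]

/-- The maximal invariant set `Λ = ⋂_{i ∈ ℤ} Fⁱ([0,1]³)`. -/
def Lam (S : HorseshoeSkewProduct) : Set Space3 := maximalInvariantSet S.domain S.F cube3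

/-- Condition (F0): `f_0` is increasing with exactly two fixed points, `0` (with
`β₀ = f_0'(0) > 1`) and `1` (with `λ₀ = f_0'(1) ∈ (0,1)`), and `f_0' ≥ λ₀`. -/
def CondF0 (S : HorseshoeSkewProduct) : Prop :=
  StrictMonoOn (S.f 0) (Icc 0 1) ∧ (∀ x ∈ Icc (0 : ℝ) 1, S.f 0 x = x ↔ x = 0 ∨ x = 1) ∧
  1 < S.df 0 0 ∧ 0 < S.df 0 1 ∧ S.df 0 1 < 1 ∧ ∀ x ∈ Icc (0 : ℝ) 1, S.df 0 1 ≤ S.df 0 x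

/-- Condition (F1): `f_1(x) = γ (1 - x)` is a contraction, and `γ ≥ λ₀`. -/
def CondF1 (S : HorseshoeSkewProduct) (γ : ℝ) : Prop :=
  (∀ x ∈ Icc (0 : ℝ) 1, S.f 1 x = γ * (1 - x)) ∧ 0 < γ ∧ γ < 1 ∧ S.df 0 1 ≤ γ

/-- Condition (F2): `f_2` is increasing and has the hyperbolic fixed points `0` (repelling) and
`p₂ ∈ (0,1)` (attracting). -/
def CondF2 (S : HorseshoeSkewProduct) : Prop :=
  StrictMonoOn (S.f 2) (Icc 0 1) ∧ S.f 2 0 = 0 ∧ 1 < S.df 2 0 ∧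
  ∃ p₂ ∈ Ioo (0 : ℝ) 1, S.f 2 p₂ = p₂ ∧ |S.df 2 p₂| < 1

/-- Condition (F01): `f_0'` is decreasing and `γ λ₀³ (1 - λ₀) / (1 - β₀⁻¹) > 1`. -/
def CondF01 (S : HorseshoeSkewProduct) (γ : ℝ) : Prop :=
  AntitoneOn (S.df 0) (Icc 0 1) ∧
  1 < γ * ((S.df 0 1) ^ 3 * (1 - S.df 0 1) / (1 - (S.df 0 0)⁻¹))

end HorseshoeSkewProduct

end

/-!
Points of the maximal invariant set are described by words in the letters `0, 1, 2` (the legs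
visited). Along a word `w` the skew product acts as
`F^[|w|] ((s, B_w u), x) = ((A_w s, u), f_w x)`, where `A_w` (`stableWord`) and `B_w`
(`unstableBranch`) are affine contractions of `[0,1]` and `f_w` (`fibreWord`) is a composition of
the fibre maps; see `iterate_F_of_word`. The proof rests on a covering property of the fibre maps:
for every interval `J` and every compact interval `K` of `(0,1)` there is a word `w` with
`K ⊆ f_w J`.

To prove it, distances in `(0,1)` are measured in the coordinate `H` with `H' = 1 / (f₀ x - x)`, the
travel time of the vector field `f₀ x - x`. As `f₀'` is decreasing, the mean value theorem gives
`f₀' x ≥ (f₀ (f₀ x) - f₀ x) / (f₀ x - x)`, which says that `f₀` does not contract this metric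
(`travelTime_sub_le_map`). The reflection `f₁` maps a neighbourhood of `1` to a
neighbourhood of `0`, and there it expands the metric by a factor close to `(1 - λ₀) / (β₀ - 1)`
(`exists_travelTime_expansion`), which is greater than `1` by `CondF01`
(`df_zero_add_df_one_lt_two`). Iterating `f₀` brings every interval of `(0,1)` close to `1`; then
`f₁` is applied, and so on. The length of the interval grows without bound, while a fundamental
domain `[x, f₀ x]` has bounded length; so iterates of `f₀` finally move the interval over `K`
(`exists_stretching_coordinate`).

An interval `J` stretched over itself by a word `w` contains a repelling fixed point `q` of `f_w`.
With the fixed points `s` of `A_w` and `u` of `B_w` it gives the saddle `Q = ((s, u), q)`. Its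
unstable manifold contains the disc `{s} × [0,1] × J` and the images of this disc along words, and
its stable manifold contains the segment `[0,1] × {u} × {q}` and its preimages along words; a disc
and a segment of these kinds meet transversely (`mem_transverseIntersection`). A point of the
maximal invariant set is determined up to a small error by a finite past and future and an interval
in the fibre (`exists_words_near`), and the covering property links this block to the past and the
future of `Q`, which yields a homoclinic point nearby. Linking two such blocks one after the other
yields an orbit from near one given point to near another one, and transitivity follows by Baire's
theorem.
-/

/-! ### Concave fibre maps and the travel time -/

/-- A map `f` of `[0,1]` with derivative `f'`, fixing `0` and `1` and no other point, and such that
`f'` is positive and weakly decreasing. -/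
structure IsConcavePush (f f' : ℝ → ℝ) : Prop where
  hasDeriv : ∀ x ∈ Icc (0 : ℝ) 1, HasDerivWithinAt f (f' x) (Icc 0 1) x
  anti : AntitoneOn f' (Icc 0 1)
  map_zero : f 0 = 0
  map_one : f 1 = 1
  pos : 0 < f' 1
  ne_self : ∀ x ∈ Ioo (0 : ℝ) 1, f x ≠ x

/-- The travel time of the flow of the vector field `f x - x` from `1 / 2` to `x`. It serves as a
coordinate on `(0,1)`, in which the distance is `∫ dx / (f x - x)`. -/
noncomputable def travelTime (f : ℝ → ℝ) (x : ℝ) : ℝ := ∫ t in (1 / 2 : ℝ)..x, (f t - t)⁻¹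

namespace IsConcavePush

variable {f f' : ℝ → ℝ}

theorem hasDerivAt (hf : IsConcavePush f f') {x : ℝ} (hx : x ∈ Ioo (0 : ℝ) 1) :
    HasDerivAt f (f' x) x :=
  (hf.hasDeriv x (Ioo_subset_Icc_self hx)).hasDerivAt (Icc_mem_nhds hx.1 hx.2)

theorem continuousOn (hf : IsConcavePush f f') : ContinuousOn f (Icc 0 1) :=
  fun x hx => (hf.hasDeriv x hx).continuousWithinAt

theorem exists_slope_eq (hf : IsConcavePush f f') {x y : ℝ} (hx : 0 ≤ x) (hxy : x < y)
    (hy : y ≤ 1) : ∃ ξ ∈ Ioo x y, f y - f x = f' ξ * (y - x) := by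
  obtain ⟨ξ, hξ, h⟩ := exists_hasDerivAt_eq_slope f f' hxy
    (hf.continuousOn.mono (Icc_subset_Icc hx hy))
    (fun z hz => hf.hasDerivAt ⟨hx.trans_lt hz.1, hz.2.trans_le hy⟩)
  refine ⟨ξ, hξ, ?_⟩
  rw [h, div_mul_cancel₀]
  exact (sub_pos.2 hxy).ne'

theorem mul_sub_le (hf : IsConcavePush f f') {x y : ℝ} (hx : 0 ≤ x) (hxy : x ≤ y) (hy : y ≤ 1) :
    f' 1 * (y - x) ≤ f y - f x := by
  rcases hxy.eq_or_lt with rfl | h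
  · simp
  obtain ⟨ξ, hξ, e⟩ := hf.exists_slope_eq hx h hy
  rw [e]
  exact mul_le_mul_of_nonneg_right (hf.anti ⟨hx.trans hξ.1.le, hξ.2.le.trans hy⟩
    (right_mem_Icc.2 zero_le_one) (hξ.2.le.trans hy)) (sub_nonneg.2 hxy)

theorem map_le_mul (hf : IsConcavePush f f') {x : ℝ} (hx : x ∈ Ioo (0 : ℝ) 1) :
    f x ≤ f' 0 * x := by
  obtain ⟨ξ, hξ, e⟩ := hf.exists_slope_eq le_rfl hx.1 hx.2.le
  rw [hf.map_zero, sub_zero, sub_zero] at e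
  rw [e]
  exact mul_le_mul_of_nonneg_right (hf.anti (left_mem_Icc.2 zero_le_one)
    ⟨hξ.1.le, hξ.2.le.trans hx.2.le⟩ hξ.1.le) hx.1.le

theorem map_lt_map (hf : IsConcavePush f f') {x y : ℝ} (hx : 0 ≤ x) (hxy : x < y) (hy : y ≤ 1) :
    f x < f y := by
  have := hf.mul_sub_le hx hxy.le hy
  have := mul_pos hf.pos (sub_pos.2 hxy)
  linarith

theorem mapsTo_Ioo (hf : IsConcavePush f f') : MapsTo f (Ioo 0 1) (Ioo 0 1) := fun x hx =>
  ⟨by simpa [hf.map_zero] using hf.map_lt_map le_rfl hx.1 hx.2.le,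
    by simpa [hf.map_one] using hf.map_lt_map hx.1.le hx.2 le_rfl⟩

theorem lt_map (hf : IsConcavePush f f') {x : ℝ} (hx : x ∈ Ioo (0 : ℝ) 1) : x < f x := by
  refine lt_of_le_of_ne ?_ (hf.ne_self x hx).symm
  by_contra! h
  obtain ⟨ξ, hξ, e⟩ := hf.exists_slope_eq le_rfl hx.1 hx.2.le
  obtain ⟨η, hη, e'⟩ := hf.exists_slope_eq hx.1.le hx.2 le_rfl
  rw [hf.map_zero, sub_zero, sub_zero] at e
  rw [hf.map_one] at e'
  have h1 : f' ξ < 1 := by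
    by_contra! h1
    nlinarith [hx.1]
  have h2 : 1 < f' η := by
    by_contra! h2
    nlinarith [hx.2]
  have := hf.anti ⟨hξ.1.le, hξ.2.le.trans hx.2.le⟩ ⟨hx.1.le.trans hη.1.le, hη.2.le⟩
    (hξ.2.le.trans hη.1.le)
  linarith

theorem iterate_mem_Ioo (hf : IsConcavePush f f') {x : ℝ} (hx : x ∈ Ioo (0 : ℝ) 1) (n : ℕ) :
    f^[n] x ∈ Ioo (0 : ℝ) 1 :=
  hf.mapsTo_Ioo.iterate n hx

theorem monotone_iterate (hf : IsConcavePush f f') {x : ℝ} (hx : x ∈ Ioo (0 : ℝ) 1) :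
    Monotone fun n => f^[n] x :=
  monotone_nat_of_le_succ fun n => by
    rw [Function.iterate_succ_apply']
    exact (hf.lt_map (hf.iterate_mem_Ioo hx n)).le

theorem tendsto_iterate (hf : IsConcavePush f f') {x : ℝ} (hx : x ∈ Ioo (0 : ℝ) 1) :
    Tendsto (fun n => f^[n] x) atTop (𝓝 1) := by
  have hb : BddAbove (range fun n => f^[n] x) :=
    ⟨1, by rintro _ ⟨n, rfl⟩; exact (hf.iterate_mem_Ioo hx n).2.le⟩
  have ht := tendsto_atTop_ciSup (hf.monotone_iterate hx) hb
  set l := ⨆ n, f^[n] x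
  have hl1 : l ≤ 1 := ciSup_le fun n => (hf.iterate_mem_Ioo hx n).2.le
  have hl0 : 0 < l := hx.1.trans_le (le_ciSup hb 0)
  rcases hl1.eq_or_lt with h | h
  · rwa [h] at ht
  · exact absurd (isFixedPt_of_tendsto_iterate ht (hf.hasDerivAt ⟨hl0, h⟩).continuousAt)
      (hf.ne_self l ⟨hl0, h⟩)

/-- By the mean value theorem and the monotonicity of `f'`, the derivative of `f` is at least the
ratio of the values of the displacement `f x - x`: `f` does not contract the travel time. -/
theorem displacement_map_le (hf : IsConcavePush f f') {x : ℝ} (hx : x ∈ Ioo (0 : ℝ) 1) :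
    f (f x) - f x ≤ f' x * (f x - x) := by
  have hfx := hf.mapsTo_Ioo hx
  have hlt := hf.lt_map hx
  obtain ⟨ξ, hξ, e⟩ := hf.exists_slope_eq hx.1.le hlt hfx.2.le
  rw [e]
  exact mul_le_mul_of_nonneg_right (hf.anti (Ioo_subset_Icc_self hx)
    ⟨hx.1.le.trans hξ.1.le, hξ.2.le.trans hfx.2.le⟩ hξ.1.le) (sub_nonneg.2 hlt.le)

theorem hasDerivAt_travelTime (hf : IsConcavePush f f') {x : ℝ} (hx : x ∈ Ioo (0 : ℝ) 1) :
    HasDerivAt (travelTime f) (f x - x)⁻¹ x := by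
  have hc : ContinuousOn (fun t => (f t - t)⁻¹) (Ioo 0 1) :=
    ((hf.continuousOn.mono Ioo_subset_Icc_self).sub continuousOn_id).inv₀
      fun t ht => (sub_pos.2 (hf.lt_map ht)).ne'
  have hsub : uIcc (1 / 2 : ℝ) x ⊆ Ioo 0 1 :=
    OrdConnected.uIcc_subset ordConnected_Ioo ⟨by norm_num, by norm_num⟩ hx
  exact intervalIntegral.integral_hasDerivAt_right (hc.mono hsub).intervalIntegrable
    (hc.stronglyMeasurableAtFilter isOpen_Ioo x hx) (hc.continuousAt (isOpen_Ioo.mem_nhds hx))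

theorem exists_travelTime_sub_eq (hf : IsConcavePush f f') {x y : ℝ} (hx : 0 < x) (hxy : x < y)
    (hy : y < 1) : ∃ ξ ∈ Ioo x y, travelTime f y - travelTime f x = (f ξ - ξ)⁻¹ * (y - x) := by
  have key : ∀ z ∈ Icc x y, HasDerivAt (travelTime f) (f z - z)⁻¹ z := fun z hz =>
    hf.hasDerivAt_travelTime ⟨hx.trans_le hz.1, hz.2.trans_lt hy⟩
  obtain ⟨ξ, hξ, h⟩ := exists_hasDerivAt_eq_slope (travelTime f) (fun z => (f z - z)⁻¹) hxy
    (fun z hz => (key z hz).continuousAt.continuousWithinAt)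
    (fun z hz => key z (Ioo_subset_Icc_self hz))
  refine ⟨ξ, hξ, ?_⟩
  rw [h, div_mul_cancel₀]
  exact (sub_pos.2 hxy).ne'

theorem sub_le_travelTime_sub (hf : IsConcavePush f f') {x y : ℝ} (hx : 0 < x) (hxy : x ≤ y)
    (hy : y < 1) : y - x ≤ travelTime f y - travelTime f x := by
  rcases hxy.eq_or_lt with rfl | h
  · simp
  obtain ⟨ξ, hξ, e⟩ := hf.exists_travelTime_sub_eq hx h hy
  have hξ' : ξ ∈ Ioo (0 : ℝ) 1 := ⟨hx.trans hξ.1, hξ.2.trans hy⟩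
  have h1 : 1 ≤ (f ξ - ξ)⁻¹ := by
    rw [one_le_inv₀ (sub_pos.2 (hf.lt_map hξ'))]
    linarith [(hf.mapsTo_Ioo hξ').2, hξ'.1]
  rw [e]
  exact le_mul_of_one_le_left (sub_nonneg.2 hxy) h1

theorem abs_sub_le_abs_travelTime_sub (hf : IsConcavePush f f') {x y : ℝ}
    (hx : x ∈ Ioo (0 : ℝ) 1) (hy : y ∈ Ioo (0 : ℝ) 1) :
    |x - y| ≤ |travelTime f x - travelTime f y| := by
  wlog h : y ≤ x generalizing x y
  · rw [abs_sub_comm x, abs_sub_comm (travelTime f x)]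
    exact this hy hx (le_of_not_ge h)
  rw [abs_of_nonneg (sub_nonneg.2 h)]
  exact (hf.sub_le_travelTime_sub hy.1 h hx.2).trans (le_abs_self _)

theorem travelTime_le (hf : IsConcavePush f f') {x y : ℝ} (hx : 0 < x) (hxy : x ≤ y)
    (hy : y < 1) : travelTime f x ≤ travelTime f y := by
  linarith [hf.sub_le_travelTime_sub hx hxy hy]

/-- In a fundamental domain `[x, f x]` the displacement is at least `f' 1` times its value at `x`,
so crossing it takes a bounded time. -/
theorem travelTime_map_sub_le (hf : IsConcavePush f f') {x : ℝ} (hx : x ∈ Ioo (0 : ℝ) 1) :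
    travelTime f (f x) - travelTime f x ≤ (f' 1)⁻¹ := by
  have hlt := hf.lt_map hx
  have hfx := hf.mapsTo_Ioo hx
  obtain ⟨ξ, hξ, e⟩ := hf.exists_travelTime_sub_eq hx.1 hlt hfx.2
  have hξ' : ξ ∈ Ioo (0 : ℝ) 1 := ⟨hx.1.trans hξ.1, hξ.2.trans hfx.2⟩
  have h1 := hf.mul_sub_le hx.1.le hξ.1.le hξ'.2.le
  have hle : f' 1 ≤ 1 := by
    have := hf.mul_sub_le le_rfl zero_le_one le_rfl
    rw [hf.map_one, hf.map_zero] at this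
    linarith
  have h2 : f' 1 * (f x - x) ≤ f ξ - ξ := by nlinarith [hξ.2]
  have h3 := sub_pos.2 (hf.lt_map hξ')
  rw [e, inv_mul_eq_div, div_le_iff₀ h3, inv_mul_eq_div, le_div_iff₀ hf.pos]
  linarith

theorem travelTime_sub_le_map (hf : IsConcavePush f f') {x y : ℝ} (hx : 0 < x) (hxy : x ≤ y)
    (hy : y < 1) :
    travelTime f y - travelTime f x ≤ travelTime f (f y) - travelTime f (f x) := by
  have hd : ∀ z ∈ Ioo (0 : ℝ) 1, HasDerivAt (fun z => travelTime f (f z) - travelTime f z)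
      ((f (f z) - f z)⁻¹ * f' z - (f z - z)⁻¹) z := fun z hz =>
    ((hf.hasDerivAt_travelTime (hf.mapsTo_Ioo hz)).comp z (hf.hasDerivAt hz)).sub
      (hf.hasDerivAt_travelTime hz)
  have hm : MonotoneOn (fun z => travelTime f (f z) - travelTime f z) (Ioo 0 1) := by
    refine monotoneOn_of_deriv_nonneg (convex_Ioo 0 1)
      (fun z hz => (hd z hz).continuousAt.continuousWithinAt) ?_ ?_
    · rw [interior_Ioo]
      exact fun z hz => (hd z hz).differentiableAt.differentiableWithinAt
    · rw [interior_Ioo]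
      intro z hz
      rw [(hd z hz).deriv, sub_nonneg, inv_mul_eq_div,
        le_div_iff₀ (sub_pos.2 (hf.lt_map (hf.mapsTo_Ioo hz))), inv_mul_eq_div,
        div_le_iff₀ (sub_pos.2 (hf.lt_map hz))]
      exact hf.displacement_map_le hz
  have := hm ⟨hx, hxy.trans_lt hy⟩ ⟨hx.trans_le hxy, hy⟩ hxy
  simp only at this
  linarith

/-- The reflection `x ↦ γ (1 - x)` carries a neighbourhood of `1`, where the displacement is
about `(1 - f' 1) (1 - x)`, to a neighbourhood of `0`, where it is at most `(f' 0 - 1) x`. Hence it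
expands the travel time by a definite factor near `1`. -/
theorem exists_travelTime_expansion (hf : IsConcavePush f f') (h0 : 1 < f' 0)
    (hsum : f' 0 + f' 1 < 2) {γ : ℝ} (hγ0 : 0 < γ) (hγ1 : γ < 1) :
    ∃ κ > 1, ∃ c ∈ Ioo (0 : ℝ) 1, ∀ x y, c ≤ x → x ≤ y → y < 1 →
      κ * (travelTime f y - travelTime f x) ≤
        travelTime f (γ * (1 - x)) - travelTime f (γ * (1 - y)) := by
  have hβ : 0 < f' 0 - 1 := sub_pos.2 h0
  -- The expansion factor tends to `(1 - f' 1) / (f' 0 - 1)` at `1`; any smaller `κ` works.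
  obtain ⟨κ, hκ1, hκ2⟩ := exists_between
    (show 1 < (1 - f' 1) / (f' 0 - 1) by rw [lt_div_iff₀ hβ]; linarith)
  rw [lt_div_iff₀ hβ] at hκ2
  refine ⟨κ, hκ1, ?_⟩
  have ht := hasDerivWithinAt_iff_tendsto_slope.1 (hf.hasDeriv 1 (right_mem_Icc.2 zero_le_one))
  have hev := ht.eventually (gt_mem_nhds (show f' 1 < 1 - κ * (f' 0 - 1) by linarith))
  have hev' : ∀ᶠ y in 𝓝[<] (1 : ℝ), slope f 1 y < 1 - κ * (f' 0 - 1) := by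
    refine Filter.Eventually.filter_mono ?_ hev
    rw [nhdsWithin_le_iff]
    filter_upwards [Ioo_mem_nhdsLT (zero_lt_one (α := ℝ))] with y hy
    exact ⟨Ioo_subset_Icc_self hy, hy.2.ne⟩
  obtain ⟨c, hc, hcs⟩ := (mem_nhdsLT_iff_exists_mem_Ico_Ioo_subset (zero_lt_one (α := ℝ))).1 hev'
  have hdisp : ∀ y ∈ Ioo c 1, κ * (f' 0 - 1) * (1 - y) ≤ f y - y := by
    intro y hy
    have h := hcs hy
    have h1 : 0 < 1 - y := sub_pos.2 hy.2
    simp only [mem_ofPred_eq, slope_def_field, hf.map_one] at h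
    rw [show (f y - 1) / (y - 1) = (1 - f y) / (1 - y) by
      rw [← neg_sub 1 (f y), ← neg_sub 1 y, neg_div_neg_eq], div_lt_iff₀ h1] at h
    linarith
  have hmid : (c + 1) / 2 ∈ Ioo (0 : ℝ) 1 := ⟨by linarith [hc.1], by linarith [hc.2]⟩
  refine ⟨(c + 1) / 2, hmid, fun x y hx hxy hy => ?_⟩
  have hg : ∀ z ∈ Ioo (0 : ℝ) 1, γ * (1 - z) ∈ Ioo (0 : ℝ) 1 := fun z hz =>
    ⟨mul_pos hγ0 (sub_pos.2 hz.2), by nlinarith [hz.1, hz.2]⟩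
  have hd : ∀ z ∈ Ioo (0 : ℝ) 1,
      HasDerivAt (fun z => -travelTime f (γ * (1 - z)) - κ * travelTime f z)
      ((f (γ * (1 - z)) - γ * (1 - z))⁻¹ * γ - κ * (f z - z)⁻¹) z := by
    intro z hz
    have h1 : HasDerivAt (fun z : ℝ => γ * (1 - z)) (γ * (-1)) z :=
      ((hasDerivAt_id z).const_sub 1).const_mul γ
    have h2 := (((hf.hasDerivAt_travelTime (hg z hz)).comp z h1).neg).sub
      ((hf.hasDerivAt_travelTime hz).const_mul κ)
    exact h2.congr_deriv (by ring)
  have hsub : ∀ z ∈ Ico ((c + 1) / 2) 1, z ∈ Ioo (0 : ℝ) 1 := fun z hz =>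
    ⟨hmid.1.trans_le hz.1, hz.2⟩
  have hm : MonotoneOn (fun z => -travelTime f (γ * (1 - z)) - κ * travelTime f z)
      (Ico ((c + 1) / 2) 1) := by
    refine monotoneOn_of_deriv_nonneg (convex_Ico _ _)
      (fun z hz => (hd z (hsub z hz)).continuousAt.continuousWithinAt) ?_ ?_
    · rw [interior_Ico]
      exact fun z hz => (hd z (hsub z (Ioo_subset_Ico_self hz))).differentiableAt
        |>.differentiableWithinAt
    · rw [interior_Ico]
      intro z hz
      have hz' := hsub z (Ioo_subset_Ico_self hz)
      rw [(hd z hz').deriv, sub_nonneg, inv_mul_eq_div,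
        le_div_iff₀ (sub_pos.2 (hf.lt_map (hg z hz'))), mul_assoc, inv_mul_eq_div,
        mul_div_assoc', div_le_iff₀ (sub_pos.2 (hf.lt_map hz'))]
      have h3 := hf.map_le_mul (hg z hz')
      have h4 := hdisp z ⟨by linarith [hz.1, hc.2], hz.2⟩
      have hκ0 : 0 < κ := by linarith
      calc κ * (f (γ * (1 - z)) - γ * (1 - z))
          ≤ κ * (f' 0 * (γ * (1 - z)) - γ * (1 - z)) := by gcongr
        _ = γ * (κ * (f' 0 - 1) * (1 - z)) := by ring
        _ ≤ γ * (f z - z) := by gcongr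
  have := hm ⟨hx, hxy.trans_lt hy⟩ ⟨hx.trans hxy, hy⟩ hxy
  simp only at this
  linarith

end IsConcavePush

namespace HorseshoeSkewProduct

variable (S : HorseshoeSkewProduct)

/-! ### Words -/

/-- The composition of the fibre maps along a word, the first letter being applied first. -/
def fibreWord : List (Fin 3) → ℝ → ℝ
  | [], x => x
  | i :: w, x => fibreWord w (S.f i x)

/-- The composition of the affine maps `s ↦ a i * s + b i` along a word, the first letter being
applied first: the action of `Φ` on the first coordinate. -/
def stableWord : List (Fin 3) → ℝ → ℝ
  | [], s => s
  | i :: w, s => stableWord w (S.a i * s + S.b i)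

/-- The inverse branch along a word of the action of `Φ` on the second coordinate: the point that
follows the word and then arrives at `u`. -/
noncomputable def unstableBranch : List (Fin 3) → ℝ → ℝ
  | [], u => u
  | i :: w, u => (unstableBranch w u - S.d i) / S.c i

theorem fibreWord_append (v w : List (Fin 3)) (x : ℝ) :
    S.fibreWord (v ++ w) x = S.fibreWord w (S.fibreWord v x) := by
  induction v generalizing x with
  | nil => rfl
  | cons i v ih => exact ih _

theorem stableWord_append (v w : List (Fin 3)) (s : ℝ) :
    S.stableWord (v ++ w) s = S.stableWord w (S.stableWord v s) := by
  induction v generalizing s with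
  | nil => rfl
  | cons i v ih => exact ih _

theorem unstableBranch_append (v w : List (Fin 3)) (u : ℝ) :
    S.unstableBranch (v ++ w) u = S.unstableBranch v (S.unstableBranch w u) := by
  induction v with
  | nil => rfl
  | cons i v ih => simp only [List.cons_append, unstableBranch, ih]

theorem mapsTo_fibreWord (w : List (Fin 3)) : MapsTo (S.fibreWord w) (Icc 0 1) (Icc 0 1) := by
  induction w with
  | nil => exact mapsTo_id _
  | cons i w ih => exact ih.comp (S.mapsTo_f i)

theorem continuousOn_fibreWord (w : List (Fin 3)) : ContinuousOn (S.fibreWord w) (Icc 0 1) := by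
  induction w with
  | nil => exact continuousOn_id
  | cons i w ih => exact ih.comp (S.contDiffOn_f i).continuousOn (S.mapsTo_f i)

theorem injOn_fibreWord (w : List (Fin 3)) : InjOn (S.fibreWord w) (Icc 0 1) := by
  induction w with
  | nil => exact injOn_id _
  | cons i w ih => exact ih.comp (S.injOn_f i) (S.mapsTo_f i)

theorem c_ne_zero (i : Fin 3) : S.c i ≠ 0 := by
  rw [← abs_pos]
  exact (abs_nonneg _).trans_lt (S.expansion_dominates i 0 0 (left_mem_Icc.2 zero_le_one))

theorem branch_mem (i : Fin 3) {u : ℝ} (hu : u ∈ Icc (0 : ℝ) 1) :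
    (u - S.d i) / S.c i ∈ Icc (S.lo i) (S.hi i) := by
  rw [← S.image_u i] at hu
  obtain ⟨v, hv, rfl⟩ := hu
  simpa [S.c_ne_zero i] using hv

theorem leg_subset (i : Fin 3) : Icc (S.lo i) (S.hi i) ⊆ Icc 0 1 :=
  Icc_subset_Icc (S.zero_le_lo i) (S.hi_le_one i)

theorem mapsTo_stableWord (w : List (Fin 3)) : MapsTo (S.stableWord w) (Icc 0 1) (Icc 0 1) := by
  induction w with
  | nil => exact mapsTo_id _
  | cons i w ih => exact ih.comp (S.maps_s i)

theorem mapsTo_unstableBranch (w : List (Fin 3)) :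
    MapsTo (S.unstableBranch w) (Icc 0 1) (Icc 0 1) := by
  induction w with
  | nil => exact mapsTo_id _
  | cons i w ih => exact fun u hu => S.leg_subset i (S.branch_mem i (ih hu))

theorem continuous_stableWord (w : List (Fin 3)) : Continuous (S.stableWord w) := by
  induction w with
  | nil => exact continuous_id
  | cons i w ih => exact ih.comp (by fun_prop)

theorem continuous_unstableBranch (w : List (Fin 3)) : Continuous (S.unstableBranch w) := by
  induction w with
  | nil => exact continuous_id
  | cons i w ih => exact (ih.sub continuous_const).div_const _

theorem abs_stableWord_sub_le {θ : ℝ} (hθ : ∀ i, |S.a i| ≤ θ) (w : List (Fin 3)) (s t : ℝ) :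
    |S.stableWord w s - S.stableWord w t| ≤ θ ^ w.length * |s - t| := by
  have hθ0 : 0 ≤ θ := (abs_nonneg _).trans (hθ 0)
  induction w generalizing s t with
  | nil => simp [stableWord]
  | cons i w ih =>
    refine (ih _ _).trans ?_
    rw [add_sub_add_right_eq_sub, ← mul_sub, abs_mul, List.length_cons, pow_succ, mul_assoc]
    gcongr
    exact hθ i

theorem abs_unstableBranch_sub_le {θ : ℝ} (hθ : ∀ i, |S.c i|⁻¹ ≤ θ) (w : List (Fin 3)) (u v : ℝ) :
    |S.unstableBranch w u - S.unstableBranch w v| ≤ θ ^ w.length * |u - v| := by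
  have hθ0 : 0 ≤ θ := (inv_nonneg.2 (abs_nonneg _)).trans (hθ 0)
  induction w with
  | nil => simp [unstableBranch]
  | cons i w ih =>
    simp only [unstableBranch, List.length_cons]
    rw [← sub_div, sub_sub_sub_cancel_right, abs_div, div_eq_mul_inv, pow_succ', mul_assoc,
      mul_comm]
    exact mul_le_mul (hθ i) ih (abs_nonneg _) hθ0

/-! ### Orbits of the skew product and words -/

theorem mem_domain {z : Space3} :
    z ∈ S.domain ↔ ∃ i, z.1.1 ∈ Icc (0 : ℝ) 1 ∧ z.1.2 ∈ Icc (S.lo i) (S.hi i) ∧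
      z.2 ∈ Icc (0 : ℝ) 1 := by
  simp only [domain, leg, mem_iUnion, mem_prod, and_assoc]

theorem F_apply {i : Fin 3} {s u x : ℝ} (hs : s ∈ Icc (0 : ℝ) 1)
    (hu : u ∈ Icc (S.lo i) (S.hi i)) :
    S.F ((s, u), x) = ((S.a i * s + S.b i, S.c i * u + S.d i), S.f i x) := by
  rw [S.F_eq i _ ⟨hs, hu⟩, S.Φ_affine i s hs u hu]

theorem domain_subset_cube3 : S.domain ⊆ cube3 := by
  intro z hz
  obtain ⟨i, h1, h2, h3⟩ := S.mem_domain.1 hz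
  exact ⟨h1, S.leg_subset i h2, h3⟩

theorem mapsTo_F_cube3 : MapsTo S.F S.domain cube3 := by
  rintro ⟨⟨s, u⟩, x⟩ hz
  obtain ⟨i, h1, h2, h3⟩ := S.mem_domain.1 hz
  rw [S.F_apply h1 h2]
  exact ⟨S.maps_s i h1, S.image_u i ▸ mem_image_of_mem _ h2, S.mapsTo_f i h3⟩

/-- The points whose first coordinate is arbitrary, and whose second one is in the image of an
inverse branch, follow the corresponding word. -/
theorem iterate_F_of_word (w : List (Fin 3)) {s u x : ℝ} (hs : s ∈ Icc (0 : ℝ) 1)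
    (hu : u ∈ Icc (0 : ℝ) 1) (hx : x ∈ Icc (0 : ℝ) 1) :
    S.F^[w.length] ((s, S.unstableBranch w u), x) =
        ((S.stableWord w s, u), S.fibreWord w x) ∧
      ∀ j < w.length, S.F^[j] ((s, S.unstableBranch w u), x) ∈ S.domain := by
  induction w generalizing s x with
  | nil => simp [stableWord, unstableBranch, fibreWord]
  | cons i w ih =>
    have hv := S.branch_mem i (S.mapsTo_unstableBranch w hu)
    have hF : S.F ((s, S.unstableBranch (i :: w) u), x) =
        ((S.a i * s + S.b i, S.unstableBranch w u), S.f i x) := by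
      rw [unstableBranch, S.F_apply hs hv]
      simp [mul_div_cancel₀, S.c_ne_zero i]
    obtain ⟨h1, h2⟩ := ih (S.maps_s i hs) (S.mapsTo_f i hx)
    refine ⟨?_, fun j hj => ?_⟩
    · rw [List.length_cons, Function.iterate_succ_apply, hF]
      exact h1
    · cases j with
      | zero => exact S.mem_domain.2 ⟨i, hs, hv, hx⟩
      | succ j =>
        rw [Function.iterate_succ_apply, hF]
        exact h2 j (by simpa using hj)

/-- An orbit segment in the domain follows a word. -/
theorem exists_word_of_iterate (n : ℕ) {Y : Space3} (hY : Y ∈ cube3)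
    (h : ∀ j < n, S.F^[j] Y ∈ S.domain) :
    ∃ w : List (Fin 3), w.length = n ∧ Y.1.2 = S.unstableBranch w (S.F^[n] Y).1.2 ∧
      (S.F^[n] Y).1.1 = S.stableWord w Y.1.1 ∧ (S.F^[n] Y).2 = S.fibreWord w Y.2 := by
  induction n generalizing Y with
  | zero => exact ⟨[], rfl, rfl, rfl, rfl⟩
  | succ n ih =>
    have hY0 : Y ∈ S.domain := h 0 n.succ_pos
    obtain ⟨w, hl, h1, h2, h3⟩ := ih (S.mapsTo_F_cube3 hY0) fun j hj => by
      rw [← Function.iterate_succ_apply]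
      exact h _ (by omega)
    obtain ⟨⟨s, u⟩, x⟩ := Y
    obtain ⟨i, hs, hu, hx⟩ := S.mem_domain.1 hY0
    rw [← Function.iterate_succ_apply] at h1 h2 h3
    have hF := S.F_apply (x := x) hs hu
    simp only [hF] at h1 h2 h3
    refine ⟨i :: w, by simp [hl], ?_, h2, h3⟩
    simp only [unstableBranch]
    rw [← h1]
    simp [S.c_ne_zero i]

/-! ### Expansion along words -/

theorem hasDerivWithinAt_f (i : Fin 3) {x : ℝ} (hx : x ∈ Icc (0 : ℝ) 1) :
    HasDerivWithinAt (S.f i) (S.df i x) (Icc 0 1) x :=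
  ((S.contDiffOn_f i).differentiableOn one_ne_zero x hx).hasDerivWithinAt

variable {S}

theorem CondF0.isConcavePush (h0 : S.CondF0) (ha : AntitoneOn (S.df 0) (Icc 0 1)) :
    IsConcavePush (S.f 0) (S.df 0) where
  hasDeriv _ hx := S.hasDerivWithinAt_f 0 hx
  anti := ha
  map_zero := (h0.2.1 0 (left_mem_Icc.2 zero_le_one)).2 (Or.inl rfl)
  map_one := (h0.2.1 1 (right_mem_Icc.2 zero_le_one)).2 (Or.inr rfl)
  pos := h0.2.2.2.1
  ne_self x hx h := by
    rcases (h0.2.1 x (Ioo_subset_Icc_self hx)).1 h with h | h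
    · exact hx.1.ne' h
    · exact hx.2.ne h

/-- With `λ = df 0 1` and `β = df 0 0`, the inequality in `CondF01` gives `1 - 1 / β < λ (1 - λ)`,
as `γ < 1` and `λ ^ 3 ≤ λ`; this excludes `β ≥ 2 - λ`. -/
theorem df_zero_add_df_one_lt_two {γ : ℝ} (h0 : S.CondF0) (h1 : S.CondF1 γ) (h01 : S.CondF01 γ) :
    S.df 0 0 + S.df 0 1 < 2 := by
  obtain ⟨-, -, hβ, hl0, hl1, -⟩ := h0
  obtain ⟨-, hγ0, hγ1, -⟩ := h1
  have h := h01.2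
  set β := S.df 0 0
  set l := S.df 0 1
  have hb : 0 < 1 - β⁻¹ := sub_pos.2 (inv_lt_one_of_one_lt₀ hβ)
  rw [mul_div_assoc', lt_div_iff₀ hb, one_mul] at h
  have hp : 0 < l ^ 3 * (1 - l) := mul_pos (pow_pos hl0 3) (sub_pos.2 hl1)
  have h' : 1 - β⁻¹ < l ^ 3 * (1 - l) := h.trans (mul_lt_of_lt_one_left hp hγ1)
  have h3 : l ^ 3 ≤ l := pow_le_of_le_one hl0.le hl1.le (by norm_num)
  have h4 : 1 - β⁻¹ < l * (1 - l) := h'.trans_le (by gcongr)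
  have h5 : β - 1 < l * (1 - l) * β := by
    have := mul_lt_mul_of_pos_right h4 (zero_lt_one.trans hβ)
    rwa [sub_mul, one_mul, inv_mul_cancel₀ (zero_lt_one.trans hβ).ne'] at this
  nlinarith [sq_nonneg (l - 1), mul_pos hl0 (sub_pos.2 hl1)]

variable (S)

/-- Along the word `w` the interval `[s,t]` is mapped onto the interval `[s',t']` of `(0,1)`, and
distances measured in the coordinate `H` grow at least by the factor `κ`. -/
structure Stretches (H : ℝ → ℝ) (κ s t : ℝ) (w : List (Fin 3)) (s' t' : ℝ) : Prop where
  pos : 0 < s'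
  lt : s' < t'
  lt_one : t' < 1
  image_eq : S.fibreWord w '' Icc s t = Icc s' t'
  expand : ∀ x ∈ Icc s t, ∀ y ∈ Icc s t,
    κ * |H x - H y| ≤ |H (S.fibreWord w x) - H (S.fibreWord w y)|

variable {S}

theorem Stretches.mapsTo {H : ℝ → ℝ} {κ s t s' t' : ℝ} {w : List (Fin 3)}
    (h : S.Stretches H κ s t w s' t') : MapsTo (S.fibreWord w) (Icc s t) (Icc s' t') :=
  fun _ hx => h.image_eq ▸ mem_image_of_mem _ hx

theorem Stretches.trans {H : ℝ → ℝ} {κ κ' s t s' t' s'' t'' : ℝ} {v w : List (Fin 3)}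
    (hκ' : 0 ≤ κ') (h : S.Stretches H κ s t v s' t') (h' : S.Stretches H κ' s' t' w s'' t'') :
    S.Stretches H (κ' * κ) s t (v ++ w) s'' t'' where
  pos := h'.pos
  lt := h'.lt
  lt_one := h'.lt_one
  image_eq := by
    rw [← h'.image_eq, ← h.image_eq, image_image]
    simp only [fibreWord_append]
  expand x hx y hy := by
    rw [fibreWord_append, fibreWord_append, mul_assoc]
    exact (mul_le_mul_of_nonneg_left (h.expand x hx y hy) hκ').trans
      (h'.expand _ (h.mapsTo hx) _ (h.mapsTo hy))

theorem Stretches.length_le {H : ℝ → ℝ} {κ s t s' t' : ℝ} {w : List (Fin 3)}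
    (h : S.Stretches H κ s t w s' t') (hκ : 0 ≤ κ) (hst : s ≤ t)
    (hH : ∀ x y, 0 < x → x ≤ y → y < 1 → H x ≤ H y) :
    κ * (H t - H s) ≤ H t' - H s' := by
  have e := h.expand t (right_mem_Icc.2 hst) s (left_mem_Icc.2 hst)
  have e1 := h.mapsTo (right_mem_Icc.2 hst)
  have e2 := h.mapsTo (left_mem_Icc.2 hst)
  have e3 := hH _ _ (h.pos.trans_le e1.1) e1.2 h.lt_one
  have e4 := hH _ _ (h.pos.trans_le e2.1) e2.2 h.lt_one
  have e5 := hH _ _ h.pos e1.1 (e1.2.trans_lt h.lt_one)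
  have e6 := hH _ _ h.pos e2.1 (e2.2.trans_lt h.lt_one)
  have e7 : |H (S.fibreWord w t) - H (S.fibreWord w s)| ≤ H t' - H s' :=
    abs_le.2 ⟨by linarith, by linarith⟩
  exact (mul_le_mul_of_nonneg_left (le_abs_self _) hκ).trans (e.trans e7)

theorem stretches_nil (H : ℝ → ℝ) {s t : ℝ} (hs : 0 < s) (hst : s < t) (ht : t < 1) :
    S.Stretches H 1 s t [] s t where
  pos := hs
  lt := hst
  lt_one := ht
  image_eq := image_id _
  expand _ _ _ _ := (one_mul _).le

theorem CondF0.image_f_zero_Icc (h0 : S.CondF0) {s t : ℝ} (hs : 0 ≤ s) (hst : s ≤ t) (ht : t ≤ 1) :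
    S.f 0 '' Icc s t = Icc (S.f 0 s) (S.f 0 t) := by
  have hsub : Icc s t ⊆ Icc 0 1 := Icc_subset_Icc hs ht
  refine Subset.antisymm ?_ (intermediate_value_Icc hst ((S.contDiffOn_f 0).continuousOn.mono hsub))
  exact ((h0.1.monotoneOn).mono hsub).mapsTo_Icc.image_subset

theorem stretches_replicate_zero (h0 : S.CondF0) (ha : AntitoneOn (S.df 0) (Icc 0 1)) {s t : ℝ}
    (hs : 0 < s) (hst : s < t) (ht : t < 1) (n : ℕ) :
    S.Stretches (travelTime (S.f 0)) 1 s t (List.replicate n 0) ((S.f 0)^[n] s)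
      ((S.f 0)^[n] t) := by
  have hf := h0.isConcavePush ha
  induction n generalizing s t with
  | zero => exact stretches_nil _ hs hst ht
  | succ n ih =>
    have hs' := hf.mapsTo_Ioo ⟨hs, hst.trans ht⟩
    have ht' := hf.mapsTo_Ioo ⟨hs.trans hst, ht⟩
    have hlt := hf.map_lt_map hs.le hst ht.le
    have h1 : S.Stretches (travelTime (S.f 0)) 1 s t [0] (S.f 0 s) (S.f 0 t) := by
      refine ⟨hs'.1, hlt, ht'.2, h0.image_f_zero_Icc hs.le hst.le ht.le, fun x hx y hy => ?_⟩
      change 1 * _ ≤ |travelTime (S.f 0) (S.f 0 x) - travelTime (S.f 0) (S.f 0 y)|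
      wlog hyx : y ≤ x generalizing x y
      · rw [abs_sub_comm, abs_sub_comm (travelTime (S.f 0) (S.f 0 x))]
        exact this y hy x hx (le_of_not_ge hyx)
      have hy0 : 0 < y := hs.trans_le hy.1
      have hx1 : x < 1 := hx.2.trans_lt ht
      rw [one_mul, abs_of_nonneg (sub_nonneg.2 (hf.travelTime_le hy0 hyx hx1))]
      exact (hf.travelTime_sub_le_map hy0 hyx hx1).trans (le_abs_self _)
    have := h1.trans zero_le_one (ih hs'.1 hlt ht'.2)
    rwa [one_mul] at this

theorem CondF1.image_f_one_Icc {γ : ℝ} (h1 : S.CondF1 γ) {s t : ℝ} (hs : 0 ≤ s) (ht : t ≤ 1) :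
    S.f 1 '' Icc s t = Icc (γ * (1 - t)) (γ * (1 - s)) := by
  have hsub : Icc s t ⊆ Icc 0 1 := Icc_subset_Icc hs ht
  rw [image_congr fun x hx => h1.1 x (hsub hx)]
  change (fun x => γ * (1 - x)) '' Icc s t = _
  rw [← image_image (fun x => γ * x) (fun x => 1 - x), image_const_sub_Icc,
    image_mul_left_Icc' h1.2.1]

/-- There is a coordinate `H` on the fibre in which every interval can be stretched over every
compact interval `[α,β]` of `(0,1)`, with a definite expansion. -/
theorem exists_stretching_coordinate {γ : ℝ} (h0 : S.CondF0) (h1 : S.CondF1 γ)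
    (h01 : S.CondF01 γ) :
    ∃ (H : ℝ → ℝ) (κ : ℝ), 1 < κ ∧
      (∀ x ∈ Ioo (0 : ℝ) 1, ∃ H', 0 < H' ∧ HasDerivAt H H' x) ∧
      (∀ x ∈ Ioo (0 : ℝ) 1, ∀ y ∈ Ioo (0 : ℝ) 1, |x - y| ≤ |H x - H y|) ∧
      ∀ s t α β, 0 < s → s < t → t < 1 → 0 < α → α ≤ β → β < 1 →
        ∃ w s' t', S.Stretches H κ s t w s' t' ∧ s' ≤ α ∧ β ≤ t' := by
  have hf := h0.isConcavePush h01.1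
  obtain ⟨κ, hκ, c, hc, hexp⟩ := hf.exists_travelTime_expansion h0.2.2.1
    (df_zero_add_df_one_lt_two h0 h1 h01) h1.2.1 h1.2.2.1
  have hκ0 : 0 < κ := zero_lt_one.trans hκ
  refine ⟨travelTime (S.f 0), κ, hκ, fun x hx => ⟨_, inv_pos.2 (sub_pos.2 (hf.lt_map hx)),
    hf.hasDerivAt_travelTime hx⟩, fun x hx y hy => hf.abs_sub_le_abs_travelTime_sub hx hy,
    fun s t α β hs hst ht hα hαβ hβ => ?_⟩
  set H := travelTime (S.f 0)
  -- A long passage near `1`, followed by the reflection, expands and lands in `(0, α]`.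
  have step : ∀ s t, 0 < s → s < t → t < 1 →
      ∃ w s' t', S.Stretches H κ s t w s' t' ∧ s' ≤ α := by
    intro s t hs hst ht
    obtain ⟨n, hn⟩ := ((hf.tendsto_iterate ⟨hs, hst.trans ht⟩).eventually
      (lt_mem_nhds (show max c (1 - α) < 1 from max_lt hc.2 (by linarith)))).exists
    have hn1 := (le_max_left c (1 - α)).trans_lt hn
    have hn2 := (le_max_right c (1 - α)).trans_lt hn
    have hz := stretches_replicate_zero h0 h01.1 hs hst ht n
    set p := (S.f 0)^[n] s
    set q := (S.f 0)^[n] t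
    have hpq := hz.lt
    have hq1 := hz.lt_one
    have hstr : S.Stretches H κ p q [1] (γ * (1 - q)) (γ * (1 - p)) := by
      refine ⟨mul_pos h1.2.1 (by linarith),
        mul_lt_mul_of_pos_left (by linarith) h1.2.1, ?_, h1.image_f_one_Icc hz.pos.le hq1.le, ?_⟩
      · nlinarith [hz.pos, h1.2.1, h1.2.2.1]
      · intro x hx y hy
        change _ ≤ |H (S.f 1 x) - H (S.f 1 y)|
        rw [h1.1 x ⟨hz.pos.le.trans hx.1, hx.2.trans hq1.le⟩,
          h1.1 y ⟨hz.pos.le.trans hy.1, hy.2.trans hq1.le⟩]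
        wlog hyx : y ≤ x generalizing x y
        · rw [abs_sub_comm, abs_sub_comm (H (γ * (1 - x)))]
          exact this y hy x hx (le_of_not_ge hyx)
        rw [abs_of_nonneg (sub_nonneg.2 (hf.travelTime_le (hz.pos.trans_le hy.1) hyx
          (hx.2.trans_lt hq1)))]
        refine (hexp y x (hn1.le.trans hy.1) hyx (hx.2.trans_lt hq1)).trans ?_
        rw [abs_sub_comm]
        exact le_abs_self _
    refine ⟨_, _, _, mul_one κ ▸ hz.trans hκ0.le hstr, ?_⟩
    nlinarith [h1.2.1, h1.2.2.1]
  have grow : ∀ k : ℕ, ∃ w s' t', S.Stretches H (κ ^ (k + 1)) s t w s' t' ∧ s' ≤ α := by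
    intro k
    induction k with
    | zero => simpa using step s t hs hst ht
    | succ k ih =>
      obtain ⟨w, s', t', h, -⟩ := ih
      obtain ⟨w', s'', t'', h', hα'⟩ := step s' t' h.pos h.lt h.lt_one
      exact ⟨_, _, _, pow_succ' κ (k + 1) ▸ h.trans hκ0.le h', hα'⟩
  have hL : 0 < H t - H s := by linarith [hf.sub_le_travelTime_sub hs hst.le ht]
  obtain ⟨k, hk⟩ := pow_unbounded_of_one_lt (((S.df 0 1)⁻¹ + (H β - H α)) / (H t - H s)) hκ
  rw [div_lt_iff₀ hL] at hk
  obtain ⟨w, s', t', h, hsα⟩ := grow k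
  have hpow : κ ^ k ≤ κ ^ (k + 1) := pow_le_pow_right₀ hκ.le k.le_succ
  have hmono : ∀ x y, 0 < x → x ≤ y → y < 1 → H x ≤ H y := fun _ _ => hf.travelTime_le
  have hlen := h.length_le (by positivity) hst.le hmono
  -- Push the long interval to the right, as long as its left endpoint stays in `(0, α]`.
  have hs' : s' ∈ Ioo (0 : ℝ) 1 := ⟨h.pos, h.lt.trans h.lt_one⟩
  have hex : ∃ n, α < (S.f 0)^[n] s' :=
    ((hf.tendsto_iterate hs').eventually (lt_mem_nhds (hαβ.trans_lt hβ))).exists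
  obtain ⟨n, hn⟩ : ∃ n, Nat.find hex = n + 1 :=
    Nat.exists_eq_succ_of_ne_zero fun h0 => by
      have := Nat.find_spec hex
      rw [h0] at this
      exact this.not_ge hsα
  have hn1 : (S.f 0)^[n] s' ≤ α := not_lt.1 (Nat.find_min hex (by omega))
  have hn2 : α < S.f 0 ((S.f 0)^[n] s') := by
    rw [← Function.iterate_succ_apply' (S.f 0), Nat.succ_eq_add_one, ← hn]
    exact Nat.find_spec hex
  have hz := stretches_replicate_zero h0 h01.1 h.pos h.lt h.lt_one n
  have hlen' := hz.length_le zero_le_one h.lt.le hmono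
  set p := (S.f 0)^[n] s'
  set q := (S.f 0)^[n] t'
  have hp : p ∈ Ioo (0 : ℝ) 1 := ⟨hz.pos, hz.lt.trans hz.lt_one⟩
  have hfund := hf.travelTime_map_sub_le hp
  have hα' := hmono _ _ hα hn2.le (hf.mapsTo_Ioo hp).2
  have hκk : κ ^ k * (H t - H s) ≤ κ ^ (k + 1) * (H t - H s) :=
    mul_le_mul_of_nonneg_right hpow hL.le
  have hHβ : H β < H q := by
    change travelTime (S.f 0) (S.f 0 p) - H p ≤ _ at hfund
    change H α ≤ travelTime (S.f 0) (S.f 0 p) at hα'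
    linarith
  have hw := h.trans zero_le_one hz
  refine ⟨w ++ List.replicate n 0, p, q, ⟨hw.pos, hw.lt, hw.lt_one, hw.image_eq, ?_⟩, hn1, ?_⟩
  · intro x hx y hy
    refine le_trans ?_ (hw.expand x hx y hy)
    rw [one_mul]
    exact mul_le_mul_of_nonneg_right (le_self_pow₀ hκ.le k.succ_ne_zero) (abs_nonneg _)
  · by_contra! hqβ
    exact hHβ.not_ge (hmono _ _ (hz.pos.trans hz.lt) hqβ.le hβ)

end HorseshoeSkewProduct

section GeneralDynamics

variable {D : Set Space3} {F : Space3 → Space3} {Q X Z : Space3}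

/-! ### Invariant manifolds, maximal invariant sets and tangent spaces -/

theorem mem_iterate_fwdImage {C : Set Space3} {n : ℕ} :
    X ∈ (fwdImage D F)^[n] C ↔ ∃ Y ∈ C, (∀ j < n, F^[j] Y ∈ D) ∧ F^[n] Y = X := by
  induction n generalizing X with
  | zero => simp
  | succ n ih =>
    rw [Function.iterate_succ_apply']
    constructor
    · rintro ⟨Z, ⟨hZ, hZD⟩, rfl⟩
      obtain ⟨Y, hY, hj, rfl⟩ := ih.1 hZ
      refine ⟨Y, hY, fun j hjn => ?_, Function.iterate_succ_apply' ..⟩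
      rcases (Nat.lt_succ_iff_lt_or_eq.1 hjn) with h | rfl
      exacts [hj j h, hZD]
    · rintro ⟨Y, hY, hj, rfl⟩
      rw [Function.iterate_succ_apply']
      exact mem_image_of_mem F
        ⟨ih.2 ⟨Y, hY, fun j h => hj j (h.trans n.lt_succ_self), rfl⟩, hj n n.lt_succ_self⟩

theorem mem_iterate_bwdImage {C : Set Space3} {n : ℕ} :
    X ∈ (bwdImage D F)^[n] C ↔ (∀ j < n, F^[j] X ∈ D) ∧ F^[n] X ∈ C := by
  induction n generalizing X with
  | zero => simp
  | succ n ih =>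
    rw [Function.iterate_succ_apply']
    change X ∈ D ∧ F X ∈ (bwdImage D F)^[n] C ↔ _
    rw [ih]
    simp only [← Function.iterate_succ_apply]
    constructor
    · rintro ⟨h0, h1, h2⟩
      refine ⟨fun j hj => ?_, h2⟩
      cases j with
      | zero => exact h0
      | succ j => exact h1 j (by omega)
    · rintro ⟨h1, h2⟩
      exact ⟨h1 0 n.succ_pos, fun j hj => h1 _ (by omega), h2⟩

theorem isClosed_maximalInvariantSet {C : Set Space3} (hF : ContinuousOn F D) (hD : IsClosed D)
    (hC : IsCompact C) : IsClosed (maximalInvariantSet D F C) := by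
  refine (isClosed_iInter fun n => IsCompact.isClosed ?_).inter (isClosed_iInter fun n => ?_)
  · induction n with
    | zero => exact hC
    | succ n ih =>
      rw [Function.iterate_succ_apply']
      exact (ih.inter_right hD).image_of_continuousOn (hF.mono inter_subset_right)
  · induction n with
    | zero => exact hC.isClosed
    | succ n ih =>
      rw [Function.iterate_succ_apply']
      exact hF.preimage_isClosed_of_isClosed hD ih

theorem iterate_orbit {x : ℤ → Space3} (hx : ∀ n, F (x n) = x (n + 1)) (n : ℤ) (j : ℕ) :
    F^[j] (x n) = x (n + j) := by
  induction j with
  | zero => simp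
  | succ j ih => rw [Function.iterate_succ_apply', ih, hx]; push_cast; ring_nf

theorem IsFullOrbit.mem_maximalInvariantSet {C : Set Space3} {x : ℤ → Space3}
    (hx : IsFullOrbit D F x) (hC : ∀ n, x n ∈ C) : x 0 ∈ maximalInvariantSet D F C := by
  have hit := iterate_orbit fun n => (hx n).2
  refine ⟨mem_iInter.2 fun n => mem_iterate_fwdImage.2 ⟨x (-n), hC _, fun j _ => ?_, ?_⟩,
    mem_iInter.2 fun n => mem_iterate_bwdImage.2 ⟨fun j _ => ?_, ?_⟩⟩
  · rw [hit]; exact (hx _).1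
  · rw [hit]; congr 1; ring
  · rw [hit]; exact (hx _).1
  · rw [hit]; exact hC _

/-- The forward half of the orbit through a point of the stable manifold and the backward half of
the orbit through a point of the unstable manifold fit together. -/
theorem exists_isFullOrbit (hs : X ∈ stableManifold D F Q) (hu : X ∈ unstableManifold D F Q) :
    ∃ x : ℤ → Space3, IsFullOrbit D F x ∧ x 0 = X := by
  obtain ⟨-, -, y, hy0, hy, -⟩ := hs
  obtain ⟨-, -, z, hz0, hz, -⟩ := hu
  refine ⟨fun n => match n with | .ofNat k => y k | .negSucc k => z (k + 1), fun n => ?_, hy0⟩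
  match n with
  | .ofNat k => exact hy k
  | .negSucc 0 => exact ⟨(hz 0).1, by simpa [hz0, hy0] using (hz 0).2⟩
  | .negSucc (k + 1) => exact hz (k + 1)

theorem exists_isPeriodicOrbitOf {m : ℕ} (hm : 0 < m) (hQ : F^[m] Q = Q)
    (hD : ∀ n, F^[n] Q ∈ D) :
    ∃ p, IsPeriodicOrbitOf D F p Q ∧ ∀ (n : ℤ) (j : ℕ), n % m = j % m → p n = F^[j] Q := by
  have hmz : (m : ℤ) ≠ 0 := by exact_mod_cast hm.ne'
  have key : ∀ (n : ℤ) (j : ℕ), n % m = j % m → F^[(n % m).toNat] Q = F^[j] Q := by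
    intro n j h
    rw [← Function.IsPeriodicPt.iterate_mod_apply (show Function.IsPeriodicPt F m Q from hQ) j, h]
    congr 1
  refine ⟨fun n => F^[(n % m).toNat] Q,
    ⟨fun n => ⟨hD _, ?_⟩, by simp, m, hm, fun n => by simp⟩, key⟩
  have h0 := Int.emod_nonneg n hmz
  rw [← Function.iterate_succ_apply' F]
  refine (key _ _ ?_).symm
  push_cast
  rw [Int.toNat_of_nonneg h0]
  simp

theorem mem_stableManifold_of_map (hX : X ∈ D) (h : F X ∈ stableManifold D F Q) :
    X ∈ stableManifold D F Q := by
  obtain ⟨p, hp, y, hy0, hy, k, hk⟩ := h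
  refine ⟨p, hp, fun n => Nat.casesOn n X y, rfl, fun n => ?_, k - 1, ?_⟩
  · cases n with
    | zero => exact ⟨hX, hy0.symm⟩
    | succ n => exact hy n
  · rw [← tendsto_add_atTop_iff_nat 1]
    refine hk.congr fun n => ?_
    simp

theorem mem_stableManifold_of_iterate {n : ℕ} (hX : ∀ j < n, F^[j] X ∈ D)
    (h : F^[n] X ∈ stableManifold D F Q) : X ∈ stableManifold D F Q := by
  induction n with
  | zero => exact h
  | succ n ih =>
    rw [Function.iterate_succ_apply'] at h
    exact ih (fun j hj => hX j (by omega)) (mem_stableManifold_of_map (hX n n.lt_succ_self) h)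

theorem map_mem_unstableManifold (hX : X ∈ D) (h : X ∈ unstableManifold D F Q) :
    F X ∈ unstableManifold D F Q := by
  obtain ⟨p, hp, y, hy0, hy, k, hk⟩ := h
  refine ⟨p, hp, fun n => Nat.casesOn n (F X) y, rfl, fun n => ?_, k + 1, ?_⟩
  · cases n with
    | zero => exact ⟨hy0.symm ▸ hX, congrArg F hy0⟩
    | succ n => exact hy n
  · rw [← tendsto_add_atTop_iff_nat 1]
    refine hk.congr fun n => ?_
    simp

theorem iterate_mem_unstableManifold {n : ℕ} (hX : ∀ j < n, F^[j] X ∈ D)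
    (h : X ∈ unstableManifold D F Q) : F^[n] X ∈ unstableManifold D F Q := by
  induction n with
  | zero => exact h
  | succ n ih =>
    rw [Function.iterate_succ_apply']
    exact map_mem_unstableManifold (hX n n.lt_succ_self) (ih fun j hj => hX j (by omega))

/-- A sequence of preimages under the `m`-th iterate that converges to the periodic point `Q` of
period `m` starts on the unstable manifold of `Q`. -/
theorem mem_unstableManifold_of_tendsto {m : ℕ} (hm : 0 < m) (hF : ContinuousOn F D)
    (hQ : F^[m] Q = Q) (hD : ∀ n, F^[n] Q ∈ D) {Y : ℕ → Space3}
    (hYD : ∀ k, ∀ j < m, F^[j] (Y (k + 1)) ∈ D) (hY : ∀ k, F^[m] (Y (k + 1)) = Y k)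
    (hlim : Tendsto Y atTop (𝓝 Q)) : Y 0 ∈ unstableManifold D F Q := by
  obtain ⟨p, hp, hpQ⟩ := exists_isPeriodicOrbitOf hm hQ hD
  have hit : ∀ k q, F^[m * q] (Y (k + q)) = Y k := by
    intro k q
    induction q with
    | zero => rfl
    | succ q ih => rw [mul_add, mul_one, Function.iterate_add_apply, ← add_assoc, hY, ih]
  -- `j` steps from `Y n`, with `j < m * n`, amount to `j % m` steps from `Y (n - j / m)`.
  have hred : ∀ n j, j < m * n → F^[j] (Y n) = F^[j % m] (Y (n - j / m)) := by
    intro n j hj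
    have hle : j / m ≤ n := (Nat.div_lt_of_lt_mul hj).le
    conv_lhs =>
      rw [← Nat.mod_add_div j m, Function.iterate_add_apply, ← Nat.sub_add_cancel hle, hit]
  have hmem : ∀ n j, j < m * n → F^[j] (Y n) ∈ D := by
    intro n j hj
    have hlt : j / m < n := Nat.div_lt_of_lt_mul hj
    rw [hred n j hj, show n - j / m = n - j / m - 1 + 1 by omega]
    exact hYD _ _ (Nat.mod_lt _ hm)
  -- The points `F^[m * n - n] (Y n)` form a backward orbit that passes through all the `Y k`.
  refine ⟨p, hp, fun n => F^[(m - 1) * n] (Y n), rfl, fun n => ⟨hmem _ _ ?_, ?_⟩, 0, ?_⟩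
  · exact Nat.mul_lt_mul_of_pos_right (by omega) n.succ_pos
  · change F (F^[(m - 1) * (n + 1)] (Y (n + 1))) = F^[(m - 1) * n] (Y n)
    rw [← Function.iterate_succ_apply' F, ← hY n, ← Function.iterate_add_apply]
    congr 2
    obtain ⟨m, rfl⟩ := Nat.exists_eq_succ_of_ne_zero hm.ne'
    simp
    ring
  have hr : ∀ r ≤ m, Tendsto (fun k => F^[r] (Y k)) atTop (𝓝 (F^[r] Q)) := by
    intro r
    induction r with
    | zero => exact fun _ => hlim
    | succ r ih =>
      intro hrm
      simp only [Function.iterate_succ_apply']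
      refine (hF _ (hD r)).tendsto.comp (tendsto_nhdsWithin_iff.2 ⟨ih (by omega), ?_⟩)
      filter_upwards [eventually_ge_atTop 1] with k hk
      exact hmem k r (by nlinarith)
  rw [Metric.tendsto_atTop]
  intro ε hε
  have hall : ∀ᶠ k in atTop, ∀ r ∈ Finset.range m, dist (F^[r] (Y k)) (F^[r] Q) < ε :=
    (Finset.eventually_all _).2 fun r hr' =>
      (Metric.tendsto_nhds.1 (hr r (Finset.mem_range.1 hr').le) ε hε)
  obtain ⟨K, hK⟩ := eventually_atTop.1 hall
  refine ⟨m * (K + 1), fun n hn => ?_⟩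
  have hn0 : 0 < n := lt_of_lt_of_le (by positivity) hn
  have hlt : (m - 1) * n < m * n := Nat.mul_lt_mul_of_pos_right (by omega) hn0
  have hpn : p (0 - n) = F^[(m - 1) * n % m] Q := by
    refine hpQ _ _ ?_
    obtain ⟨m, rfl⟩ := Nat.exists_eq_succ_of_ne_zero hm.ne'
    push_cast
    rw [Int.emod_emod_of_dvd _ dvd_rfl]
    exact Int.modEq_iff_dvd.2 ⟨n, by simp; ring⟩
  change dist (dist (F^[(m - 1) * n] (Y n)) (p (0 - n))) 0 < ε
  rw [Real.dist_eq, sub_zero, abs_of_nonneg dist_nonneg, hpn, hred _ _ hlt]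
  refine hK _ ?_ _ (Finset.mem_range.2 (Nat.mod_lt _ hm))
  have h1 : (m - 1) * n / m + (K + 1) ≤ n := by
    rw [← Nat.add_mul_div_left _ _ hm, ]
    refine Nat.div_le_of_le_mul ?_
    obtain ⟨m, rfl⟩ := Nat.exists_eq_succ_of_ne_zero hm.ne'
    simp at *
    nlinarith
  omega

theorem mem_tangentAt_of_segment {W : Set Space3} {v : Space3}
    (h : ∀ t ∈ Icc (0 : ℝ) 1, X + t • v ∈ W) : v ∈ tangentAt W X := by
  refine Submodule.subset_span ⟨fun t => X + t • v, by fun_prop, h, by simp, ?_⟩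
  have := ((hasDerivAt_id (0 : ℝ)).smul_const v).const_add X
  simpa using this.hasDerivWithinAt

/-- A segment in the first direction in `V`, and segments in the two other directions in `W`, make
the intersection transverse. -/
theorem mem_transverseIntersection_of_segments {V W : Set Space3} {s u x s' u' x' : ℝ}
    (hs : s' ≠ s) (hu : u' ≠ u) (hx : x' ≠ x)
    (hV : ∀ r ∈ uIcc s s', ((r, u), x) ∈ V) (hWu : ∀ r ∈ uIcc u u', ((s, r), x) ∈ W)
    (hWx : ∀ r ∈ uIcc x x', ((s, u), r) ∈ W) :
    ((s, u), x) ∈ transverseIntersection V W := by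
  refine ⟨hV s left_mem_uIcc, hWu u left_mem_uIcc, ?_⟩
  have hseg : ∀ {a b t : ℝ}, t ∈ Icc (0 : ℝ) 1 → a + t * (b - a) ∈ uIcc a b := by
    intro a b t ht
    rw [← segment_eq_uIcc, segment_eq_image']
    exact ⟨t, ht, by simp⟩
  have h1 : ((s' - s, 0), 0) ∈ tangentAt V ((s, u), x) := mem_tangentAt_of_segment fun t ht => by
    simpa using hV _ (hseg ht)
  have h2 : ((0, u' - u), 0) ∈ tangentAt W ((s, u), x) := mem_tangentAt_of_segment fun t ht => by
    simpa using hWu _ (hseg ht)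
  have h3 : ((0, 0), x' - x) ∈ tangentAt W ((s, u), x) := mem_tangentAt_of_segment fun t ht => by
    simpa using hWx _ (hseg ht)
  refine eq_top_iff.2 fun v _ => ?_
  have e : v = (v.1.1 / (s' - s)) • ((s' - s, 0), 0) +
      ((v.1.2 / (u' - u)) • ((0, u' - u), 0) + (v.2 / (x' - x)) • ((0, 0), x' - x)) := by
    ext <;> simp [sub_ne_zero.2 hs, sub_ne_zero.2 hu, sub_ne_zero.2 hx]
  rw [e]
  exact Submodule.add_mem_sup (Submodule.smul_mem _ _ h1)
    (Submodule.add_mem _ (Submodule.smul_mem _ _ h2) (Submodule.smul_mem _ _ h3))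

theorem derivIter_succ_apply (n : ℕ) (X : Space3) :
    derivIter D F (n + 1) X = (derivIter D F n (F X)).comp (fderivWithin ℝ F D X) := by
  induction n with
  | zero => rfl
  | succ n ih =>
    rw [derivIter, ih, derivIter, Function.iterate_succ_apply]
    rfl

end GeneralDynamics

namespace HorseshoeSkewProduct

variable (S : HorseshoeSkewProduct)

/-! ### The derivative of the skew product -/

/-- The diagonal linear map of `ℝ³` with the entries `a`, `c`, `μ`. -/
noncomputable def diagMap (a c μ : ℝ) : Space3 →L[ℝ] Space3 :=
  ((a • ContinuousLinearMap.id ℝ ℝ).prodMap (c • ContinuousLinearMap.id ℝ ℝ)).prodMap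
    (μ • ContinuousLinearMap.id ℝ ℝ)

theorem diagMap_comp (a c μ a' c' μ' : ℝ) :
    (diagMap a c μ).comp (diagMap a' c' μ') = diagMap (a * a') (c * c') (μ * μ') := by
  ext <;> simp [diagMap]

theorem complexEigenvalues_diagMap (a c μ : ℝ) :
    complexEigenvalues (diagMap a c μ) = {(a : ℂ), (c : ℂ), (μ : ℂ)} := by
  have h1 : ∀ r : ℝ, LinearMap.charpoly (r • LinearMap.id : ℝ →ₗ[ℝ] ℝ) =
      Polynomial.X - Polynomial.C r := by
    intro r
    have := LinearMap.charpoly_sub_smul (0 : Module.End ℝ ℝ) (-r)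
    rw [LinearMap.charpoly_zero, Module.finrank_self, pow_one] at this
    rw [show (r • LinearMap.id : ℝ →ₗ[ℝ] ℝ) = 0 - (-r) • (1 : Module.End ℝ ℝ) by ext; simp, this,
      Polynomial.X_comp, map_neg, sub_eq_add_neg]
  have h2 : LinearMap.charpoly (diagMap a c μ : Space3 →ₗ[ℝ] Space3) =
      (Polynomial.X - Polynomial.C a) * (Polynomial.X - Polynomial.C c) *
        (Polynomial.X - Polynomial.C μ) := by
    rw [← h1, ← h1, ← h1, ← LinearMap.charpoly_prodMap, ← LinearMap.charpoly_prodMap]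
    rfl
  have hne : ∀ r : ℝ, (Polynomial.X - Polynomial.C r : Polynomial ℝ) ≠ 0 :=
    Polynomial.X_sub_C_ne_zero
  rw [complexEigenvalues, h2, Polynomial.aroots_mul (mul_ne_zero (mul_ne_zero (hne _) (hne _))
    (hne _)), Polynomial.aroots_mul (mul_ne_zero (hne _) (hne _))]
  simp only [Polynomial.aroots_X_sub_C]
  rfl

theorem isClosed_leg_prod (i : Fin 3) : IsClosed (S.leg i ×ˢ Icc (0 : ℝ) 1) :=
  (isClosed_Icc.prod isClosed_Icc).prod isClosed_Icc

theorem isClosed_domain : IsClosed S.domain := isClosed_iUnion_of_finite S.isClosed_leg_prod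

theorem leg_prod_mem_nhdsWithin {i : Fin 3} {z : Space3} (hz : z ∈ S.leg i ×ˢ Icc (0 : ℝ) 1) :
    S.leg i ×ˢ Icc (0 : ℝ) 1 ∈ 𝓝[S.domain] z := by
  have h : ∀ᶠ y in 𝓝 z, ∀ j, j ≠ i → y ∉ S.leg j ×ˢ Icc (0 : ℝ) 1 := by
    refine eventually_all.2 fun j => ?_
    by_cases hj : j = i
    · exact Eventually.of_forall fun y h => absurd hj h
    · filter_upwards [(S.isClosed_leg_prod j).isOpen_compl.mem_nhds fun h =>
        Set.disjoint_left.1 (S.disjoint_legs j i hj) h.1.2 hz.1.2] with y hy _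
      exact hy
  filter_upwards [self_mem_nhdsWithin, nhdsWithin_le_nhds h] with y hy hy'
  obtain ⟨j, hj⟩ := mem_iUnion.1 hy
  by_cases hji : j = i
  · exact hji ▸ hj
  · exact absurd hj (hy' j hji)

theorem hasFDerivWithinAt_F {i : Fin 3} {z : Space3} (hz : z ∈ S.leg i ×ˢ Icc (0 : ℝ) 1) :
    HasFDerivWithinAt S.F (diagMap (S.a i) (S.c i) (S.df i z.2)) S.domain z := by
  have h1 : HasFDerivAt (fun y : Space3 => (S.a i * y.1.1 + S.b i, S.c i * y.1.2 + S.d i))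
      (((S.a i • ContinuousLinearMap.id ℝ ℝ).prodMap
        (S.c i • ContinuousLinearMap.id ℝ ℝ)).comp (ContinuousLinearMap.fst ℝ (ℝ × ℝ) ℝ)) z := by
    have e1 : HasFDerivAt (fun y : Space3 => y.1.1) ((ContinuousLinearMap.fst ℝ ℝ ℝ).comp
      (ContinuousLinearMap.fst ℝ (ℝ × ℝ) ℝ)) z :=
      hasFDerivAt_fst.comp z hasFDerivAt_fst
    have e2 : HasFDerivAt (fun y : Space3 => y.1.2) ((ContinuousLinearMap.snd ℝ ℝ ℝ).comp
      (ContinuousLinearMap.fst ℝ (ℝ × ℝ) ℝ)) z :=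
      hasFDerivAt_snd.comp z hasFDerivAt_fst
    exact ((e1.const_mul (S.a i)).add_const (S.b i)).prodMk
      ((e2.const_mul (S.c i)).add_const (S.d i))
  have h2 : HasFDerivWithinAt (fun y : Space3 => S.f i y.2)
      ((S.df i z.2 • ContinuousLinearMap.id ℝ ℝ).comp (ContinuousLinearMap.snd ℝ (ℝ × ℝ) ℝ))
      (S.leg i ×ˢ Icc (0 : ℝ) 1) z := by
    have := (S.hasDerivWithinAt_f i hz.2).hasFDerivWithinAt.comp z
      (hasFDerivWithinAt_snd (s := S.leg i ×ˢ Icc (0 : ℝ) 1)) fun y hy => hy.2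
    refine this.congr_fderiv ?_
    ext <;> simp
  refine HasFDerivWithinAt.mono_of_mem_nhdsWithin ?_ (S.leg_prod_mem_nhdsWithin hz)
  refine (h1.hasFDerivWithinAt.prodMk h2).congr (fun y hy => ?_) ?_
  · exact S.F_apply hy.1.1 hy.1.2
  · exact S.F_apply hz.1.1 hz.1.2

theorem continuousOn_F : ContinuousOn S.F S.domain := fun z hz => by
  obtain ⟨i, hi⟩ := mem_iUnion.1 hz
  exact (S.hasFDerivWithinAt_F hi).continuousWithinAt

theorem fderivWithin_F {i : Fin 3} {z : Space3} (hz : z ∈ S.leg i ×ˢ Icc (0 : ℝ) 1) :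
    fderivWithin ℝ S.F S.domain z = diagMap (S.a i) (S.c i) (S.df i z.2) := by
  refine (S.hasFDerivWithinAt_F hz).fderivWithin (UniqueDiffWithinAt.mono ?_
    (subset_iUnion (fun i => S.leg i ×ˢ Icc (0 : ℝ) 1) i))
  exact ((uniqueDiffOn_Icc_zero_one.prod (uniqueDiffOn_Icc (S.lo_lt_hi i))).prod
    uniqueDiffOn_Icc_zero_one) z hz

/-- The derivative of the iterate of `F` that follows the word `w`. -/
theorem exists_derivIter_eq (w : List (Fin 3)) {s u x : ℝ} (hs : s ∈ Icc (0 : ℝ) 1)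
    (hu : u ∈ Icc (0 : ℝ) 1) (hx : x ∈ Icc (0 : ℝ) 1) :
    ∃ μ, HasDerivWithinAt (S.fibreWord w) μ (Icc 0 1) x ∧
      derivIter S.domain S.F w.length ((s, S.unstableBranch w u), x) =
        diagMap (w.map S.a).prod (w.map S.c).prod μ := by
  induction w generalizing s x with
  | nil => exact ⟨1, hasDerivWithinAt_id x _, by ext <;> simp [derivIter, diagMap]⟩
  | cons i w ih =>
    have hv := S.branch_mem i (S.mapsTo_unstableBranch w hu)
    obtain ⟨μ, h1, h2⟩ := ih (S.maps_s i hs) (S.mapsTo_f i hx)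
    refine ⟨μ * S.df i x, h1.comp x (S.hasDerivWithinAt_f i hx) (S.mapsTo_f i), ?_⟩
    have hF : S.F ((s, S.unstableBranch (i :: w) u), x) =
        ((S.a i * s + S.b i, S.unstableBranch w u), S.f i x) := by
      rw [unstableBranch, S.F_apply hs hv]
      simp [mul_div_cancel₀, S.c_ne_zero i]
    rw [List.length_cons, derivIter_succ_apply, hF, h2,
      S.fderivWithin_F (i := i) ⟨⟨hs, hv⟩, hx⟩, diagMap_comp, List.map_cons, List.prod_cons,
      List.map_cons, List.prod_cons, mul_comm (S.a i), mul_comm (S.c i)]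

variable {S}

theorem CondF0.abs_a_le (h0 : S.CondF0) (i : Fin 3) : |S.a i| ≤ S.df 0 1 := by
  have := S.contraction_dominates i 0 1 (right_mem_Icc.2 zero_le_one)
  exact (this.trans_eq (abs_of_pos h0.2.2.2.1)).le

theorem df_zero_le_abs_c (S : HorseshoeSkewProduct) (i : Fin 3) : S.df 0 0 ≤ |S.c i| := by
  have := S.expansion_dominates i 0 0 (left_mem_Icc.2 zero_le_one)
  exact ((le_abs_self _).trans_lt this).le

theorem CondF0.inv_df_zero_nonneg (h0 : S.CondF0) : 0 ≤ (S.df 0 0)⁻¹ :=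
  inv_nonneg.2 (zero_le_one.trans h0.2.2.1.le)

theorem CondF0.inv_abs_c_le (h0 : S.CondF0) (i : Fin 3) : |S.c i|⁻¹ ≤ (S.df 0 0)⁻¹ :=
  inv_anti₀ (zero_lt_one.trans h0.2.2.1) (S.df_zero_le_abs_c i)

theorem CondF0.abs_prod_a_lt (h0 : S.CondF0) {w : List (Fin 3)} (hw : w ≠ []) :
    |(w.map S.a).prod| < 1 := by
  have h : ∀ w : List (Fin 3), |(w.map S.a).prod| ≤ (S.df 0 1) ^ w.length := by
    intro w
    induction w with
    | nil => simp
    | cons i w ih =>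
      rw [List.map_cons, List.prod_cons, abs_mul, List.length_cons, pow_succ']
      exact mul_le_mul (h0.abs_a_le i) ih (abs_nonneg _) h0.2.2.2.1.le
  exact (h w).trans_lt (pow_lt_one₀ h0.2.2.2.1.le h0.2.2.2.2.1 (by simpa using hw))

theorem CondF0.one_lt_abs_prod_c (h0 : S.CondF0) {w : List (Fin 3)} (hw : w ≠ []) :
    1 < |(w.map S.c).prod| := by
  have h : ∀ w : List (Fin 3), (S.df 0 0) ^ w.length ≤ |(w.map S.c).prod| := by
    intro w
    induction w with
    | nil => simp
    | cons i w ih =>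
      rw [List.map_cons, List.prod_cons, abs_mul, List.length_cons, pow_succ']
      exact mul_le_mul (S.df_zero_le_abs_c i) ih (pow_nonneg (zero_le_one.trans h0.2.2.1.le) _)
        (abs_nonneg _)
  exact (one_lt_pow₀ h0.2.2.1 (by simpa using hw)).trans_le (h w)

end HorseshoeSkewProduct

/-- A map that expands distances by `κ`, in a coordinate `H` with positive derivative, has at a
fixed point a derivative of modulus at least `κ`. -/
theorem le_abs_deriv_of_expanding {H g : ℝ → ℝ} {κ H' μ s t q : ℝ} (hst : s < t)
    (hq : q ∈ Icc s t) (hgq : g q = q) (hH' : 0 < H') (hH : HasDerivAt H H' q)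
    (hg : HasDerivWithinAt g μ (Icc s t) q)
    (hexp : ∀ x ∈ Icc s t, κ * |H x - H q| ≤ |H (g x) - H q|) : κ ≤ |μ| := by
  have h1 : HasDerivWithinAt (H ∘ g) (H' * μ) (Icc s t) q :=
    HasDerivAt.comp_hasDerivWithinAt q (by rwa [hgq]) hg
  have t1 := (hasDerivWithinAt_iff_tendsto_slope.1 h1).abs
  have t2 := ((hasDerivWithinAt_iff_tendsto_slope.1
    (hH.hasDerivWithinAt (s := Icc s t))).abs).const_mul κ
  have hne : (𝓝[Icc s t \ {q}] q).NeBot :=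
    accPt_principal_iff_nhdsWithin.1 ((uniqueDiffOn_Icc hst) q hq).accPt
  have h2 : κ * |H'| ≤ |H' * μ| := by
    refine le_of_tendsto_of_tendsto t2 t1 ?_
    filter_upwards [self_mem_nhdsWithin] with x hx
    rw [slope_def_field, slope_def_field, abs_div, abs_div, mul_div_assoc', Function.comp,
      Function.comp, hgq]
    gcongr
    exact hexp x hx.1
  rw [abs_mul, abs_of_pos hH', mul_comm] at h2
  exact le_of_mul_le_mul_left h2 hH'

/-! ### Transitivity from a dense set of connections -/

/-- Birkhoff's criterion: on a nonempty closed invariant set, if some orbit segment leads from any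
open set to any other one, then some orbit is dense. -/
theorem isTopologicallyTransitive_of_exists_dist_lt {F : Space3 → Space3} {L : Set Space3}
    (hL : IsClosed L) (hne : L.Nonempty) (hF : ContinuousOn F L) (hmaps : MapsTo F L L)
    (h : ∀ X ∈ L, ∀ Y ∈ L, ∀ ε > 0, ∃ Z ∈ L, ∃ n, dist Z X < ε ∧ dist (F^[n] Z) Y < ε) :
    IsTopologicallyTransitive F L := by
  have : CompleteSpace L := hL.completeSpace_coe
  have : Nonempty L := hne.to_subtype
  set g : L → L := hmaps.restrict F L L
  have hg : Continuous g := hF.mapsToRestrict hmaps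
  have hcoe : ∀ (n : ℕ) (X : L), ((g^[n] X : L) : Space3) = F^[n] X := fun n X => by
    induction n with
    | zero => rfl
    | succ n ih => rw [Function.iterate_succ_apply', Function.iterate_succ_apply', ← ih]; rfl
  have hdense : ∀ b ∈ TopologicalSpace.countableBasis L, Dense (⋃ n : ℕ, g^[n] ⁻¹' b) := by
    intro b hb
    obtain ⟨Y, hY⟩ := TopologicalSpace.nonempty_of_mem_countableBasis hb
    obtain ⟨δ, hδ, hball⟩ := Metric.isOpen_iff.1 (TopologicalSpace.isOpen_of_mem_countableBasis hb)
      Y hY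
    rw [Metric.dense_iff]
    intro X ε hε
    obtain ⟨Z, hZ, n, h1, h2⟩ := h X X.2 Y Y.2 (min ε δ) (lt_min hε hδ)
    refine ⟨⟨Z, hZ⟩, h1.trans_le (min_le_left _ _), mem_iUnion.2 ⟨n, hball ?_⟩⟩
    rw [Metric.mem_ball, Subtype.dist_eq, hcoe]
    exact h2.trans_le (min_le_right _ _)
  obtain ⟨X, hX⟩ := (dense_biInter_of_isOpen
    (fun b hb => isOpen_iUnion fun n =>
      (TopologicalSpace.isOpen_of_mem_countableBasis hb).preimage (hg.iterate n))
    (TopologicalSpace.countable_countableBasis L) hdense).nonempty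
  refine ⟨X, X.2, Subset.antisymm (closure_minimal ?_ hL) fun Y hY => ?_⟩
  · rintro _ ⟨n, rfl⟩
    change F^[n] (X : Space3) ∈ L
    rw [← hcoe]
    exact (g^[n] X).2
  · have hd : Dense (range fun n : ℕ => g^[n] X) := by
      refine (TopologicalSpace.isBasis_countableBasis L).dense_iff.2 fun b hb _ => ?_
      obtain ⟨n, hn⟩ := mem_iUnion.1 (mem_iInter₂.1 hX b hb)
      exact ⟨_, hn, n, rfl⟩
    have := image_closure_subset_closure_image continuous_subtype_val
      (mem_image_of_mem Subtype.val (hd ⟨Y, hY⟩))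
    rw [← range_comp] at this
    refine closure_mono (range_subset_range_iff_exists_comp.2 ⟨id, ?_⟩) this
    ext1 n
    exact hcoe n X

namespace HorseshoeSkewProduct

variable {S : HorseshoeSkewProduct}

/-! ### The saddle -/

/-- Every non-degenerate interval of the open fibre `(0,1)` can be mapped over every compact
interval of it by a word. -/
def CoveringProperty (S : HorseshoeSkewProduct) : Prop :=
  ∀ s t α β : ℝ, 0 < s → s < t → t < 1 → 0 < α → α ≤ β → β < 1 →
    ∃ w, Icc α β ⊆ S.fibreWord w '' Icc s t

theorem CoveringProperty.exists_append (hS : S.CoveringProperty) (v : List (Fin 3)) {s t α β : ℝ}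
    (hs : 0 < s) (hst : s < t) (ht : t < 1) (hα : 0 < α) (hαβ : α ≤ β) (hβ : β < 1) :
    ∃ w, Icc α β ⊆ S.fibreWord (v ++ w) '' Icc s t := by
  have hs' : s ∈ Icc (0 : ℝ) 1 := ⟨hs.le, (hst.trans ht).le⟩
  have ht' : t ∈ Icc (0 : ℝ) 1 := ⟨(hs.trans hst).le, ht.le⟩
  have hne : S.fibreWord v s ≠ S.fibreWord v t := fun h =>
    hst.ne (S.injOn_fibreWord v hs' ht' h)
  have hlt := min_lt_max.2 hne
  have hp := le_min (S.mapsTo_fibreWord v hs').1 (S.mapsTo_fibreWord v ht').1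
  have hq := max_le (S.mapsTo_fibreWord v hs').2 (S.mapsTo_fibreWord v ht').2
  have hivt : uIcc (S.fibreWord v s) (S.fibreWord v t) ⊆ S.fibreWord v '' Icc s t := by
    rw [← uIcc_of_le hst.le]
    exact intermediate_value_uIcc ((S.continuousOn_fibreWord v).mono
      (uIcc_of_le hst.le ▸ Icc_subset_Icc hs.le ht.le))
  rw [uIcc] at hivt
  set p := min (S.fibreWord v s) (S.fibreWord v t)
  set q := max (S.fibreWord v s) (S.fibreWord v t)
  obtain ⟨w, hw⟩ := hS ((2 * p + q) / 3) ((p + 2 * q) / 3) α β (by linarith) (by linarith)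
    (by linarith) hα hαβ hβ
  refine ⟨w, fun z hz => ?_⟩
  obtain ⟨y, hy, rfl⟩ := hw hz
  obtain ⟨x, hx, rfl⟩ := hivt (show y ∈ Icc p q from
    ⟨by linarith [hy.1], by linarith [hy.2]⟩)
  exact ⟨x, hx, S.fibreWord_append v w x⟩

/-- A word whose periodic point `((sq, uq), q)` is expanding in the fibre, and such that the
interval `[σ,τ]` of the fibre is contained in the unstable set of `q`. -/
structure IsExpandingPeriodic (S : HorseshoeSkewProduct) (w : List (Fin 3)) (σ τ q sq uq : ℝ) :
    Prop where
  ne_nil : w ≠ []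
  pos : 0 < σ
  lt : σ < τ
  lt_one : τ < 1
  q_mem : q ∈ Icc σ τ
  q_fix : S.fibreWord w q = q
  s_mem : sq ∈ Icc (0 : ℝ) 1
  s_fix : S.stableWord w sq = sq
  u_mem : uq ∈ Icc (0 : ℝ) 1
  u_fix : S.unstableBranch w uq = uq
  preimages : ∀ y ∈ Icc σ τ, ∃ Y : ℕ → ℝ, Y 0 = y ∧ (∀ k, Y k ∈ Icc σ τ) ∧
    (∀ k, S.fibreWord w (Y (k + 1)) = Y k) ∧ Tendsto Y atTop (𝓝 q)
  expanding : ∀ μ, HasDerivWithinAt (S.fibreWord w) μ (Icc 0 1) q → 1 < |μ|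

/-- An interval that is stretched over itself contains a repelling fixed point, to which all
backward orbits in the interval converge. -/
theorem exists_isExpandingPeriodic {γ : ℝ} (h0 : S.CondF0) (h1 : S.CondF1 γ)
    (h01 : S.CondF01 γ) :
    S.CoveringProperty ∧ ∃ w σ τ q sq uq, S.IsExpandingPeriodic w σ τ q sq uq := by
  obtain ⟨H, κ, hκ, hHd, hHdist, hcov⟩ := exists_stretching_coordinate h0 h1 h01
  refine ⟨fun s t α β hs hst ht hα hαβ hβ => ?_, ?_⟩
  · obtain ⟨w, s', t', h, hs', ht'⟩ := hcov s t α β hs hst ht hα hαβ hβ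
    exact ⟨w, h.image_eq ▸ Icc_subset_Icc hs' ht'⟩
  obtain ⟨σ, τ, hσ, hστ, hτ⟩ : ∃ σ τ : ℝ, 0 < σ ∧ σ < τ ∧ τ < 1 :=
    ⟨1 / 3, 2 / 3, by norm_num, by norm_num, by norm_num⟩
  obtain ⟨w, s', t', h, hs', ht'⟩ := hcov σ τ σ τ hσ hστ hτ hσ hστ.le hτ
  have hsub01 : Icc σ τ ⊆ Icc (0 : ℝ) 1 := Icc_subset_Icc hσ.le hτ.le
  have hsub : Icc σ τ ⊆ S.fibreWord w '' Icc σ τ := h.image_eq ▸ Icc_subset_Icc hs' ht'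
  have hcont := (S.continuousOn_fibreWord w).mono hsub01
  have hIoo : ∀ x ∈ Icc σ τ, x ∈ Ioo (0 : ℝ) 1 := fun x hx =>
    ⟨hσ.trans_le hx.1, hx.2.trans_lt hτ⟩
  obtain ⟨q, hq, hqfix⟩ : ∃ q ∈ Icc σ τ, S.fibreWord w q = q := by
    obtain ⟨x, hx, hxσ⟩ := hsub (left_mem_Icc.2 hστ.le)
    obtain ⟨y, hy, hyτ⟩ := hsub (right_mem_Icc.2 hστ.le)
    exact isPreconnected_Icc.intermediate_value₂ hx hy hcont continuousOn_id
      (hxσ.trans_le hx.1) (hyτ.symm ▸ hy.2)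
  obtain ⟨sq, hsq, hsfix⟩ := exists_mem_Icc_isFixedPt_of_mapsTo
    (S.continuous_stableWord w).continuousOn zero_le_one (S.mapsTo_stableWord w)
  obtain ⟨uq, huq, hufix⟩ := exists_mem_Icc_isFixedPt_of_mapsTo
    (S.continuous_unstableBranch w).continuousOn zero_le_one (S.mapsTo_unstableBranch w)
  have hκ0 : 0 < κ := zero_lt_one.trans hκ
  refine ⟨w, σ, τ, q, sq, uq, ?_, hσ, hστ, hτ, hq, hqfix, hsq, hsfix, huq, hufix, ?_, ?_⟩
  · rintro rfl
    have h1 := h.expand τ (right_mem_Icc.2 hστ.le) σ (left_mem_Icc.2 hστ.le)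
    have h2 := hHdist τ (hIoo _ (right_mem_Icc.2 hστ.le)) σ (hIoo _ (left_mem_Icc.2 hστ.le))
    have h3 : 0 < |τ - σ| := abs_pos.2 (sub_ne_zero.2 hστ.ne')
    simp only [fibreWord] at h1
    nlinarith
  · intro y hy
    choose! g hgm hg using hsub
    have hm : ∀ k, g^[k] y ∈ Icc σ τ := fun k => (MapsTo.iterate hgm k) hy
    have hstep : ∀ k, S.fibreWord w (g^[k + 1] y) = g^[k] y := fun k => by
      rw [Function.iterate_succ_apply']
      exact hg (hm k)
    have hH : ∀ k, κ ^ k * |H (g^[k] y) - H q| ≤ |H y - H q| := by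
      intro k
      induction k with
      | zero => simp
      | succ k ih =>
        have := h.expand _ (hm (k + 1)) q hq
        rw [hstep, hqfix] at this
        calc κ ^ (k + 1) * |H (g^[k + 1] y) - H q|
            = κ ^ k * (κ * |H (g^[k + 1] y) - H q|) := by ring
          _ ≤ κ ^ k * |H (g^[k] y) - H q| := by gcongr
          _ ≤ _ := ih
    refine ⟨fun k => g^[k] y, rfl, hm, hstep, ?_⟩
    rw [tendsto_iff_dist_tendsto_zero]
    refine squeeze_zero (fun _ => dist_nonneg) (fun k => ?_)
      (g := fun k => κ⁻¹ ^ k * |H y - H q|) ?_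
    · rw [Real.dist_eq, inv_pow, inv_mul_eq_div, le_div_iff₀ (pow_pos hκ0 k), mul_comm]
      exact (mul_le_mul_of_nonneg_left (hHdist _ (hIoo _ (hm k)) _ (hIoo _ hq))
        (pow_pos hκ0 k).le).trans (hH k)
    · simpa using (tendsto_pow_atTop_nhds_zero_of_lt_one (inv_pos.2 hκ0).le
        (inv_lt_one_of_one_lt₀ hκ)).mul_const |H y - H q|
  · intro μ hμ
    obtain ⟨H', hH', hHq⟩ := hHd q (hIoo q hq)
    refine hκ.trans_le (le_abs_deriv_of_expanding hστ hq hqfix hH' hHq (hμ.mono hsub01)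
      fun x hx => ?_)
    have := h.expand x hx q hq
    rwa [hqfix] at this

namespace IsExpandingPeriodic

variable {w : List (Fin 3)} {σ τ q sq uq : ℝ}

theorem subset_Icc (P : S.IsExpandingPeriodic w σ τ q sq uq) : Icc σ τ ⊆ Icc 0 1 :=
  Icc_subset_Icc P.pos.le P.lt_one.le

theorem length_pos (P : S.IsExpandingPeriodic w σ τ q sq uq) : 0 < w.length :=
  List.length_pos_iff.2 P.ne_nil

theorem iterate_eq (P : S.IsExpandingPeriodic w σ τ q sq uq) :
    S.F^[w.length] ((sq, uq), q) = ((sq, uq), q) := by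
  have := (S.iterate_F_of_word w P.s_mem P.u_mem (P.subset_Icc P.q_mem)).1
  rwa [P.u_fix, P.s_fix, P.q_fix] at this

theorem iterate_mem (P : S.IsExpandingPeriodic w σ τ q sq uq) (n : ℕ) :
    S.F^[n] ((sq, uq), q) ∈ S.domain := by
  have := (S.iterate_F_of_word w P.s_mem P.u_mem (P.subset_Icc P.q_mem)).2
  rw [P.u_fix] at this
  rw [← Function.IsPeriodicPt.iterate_mod_apply
    (show Function.IsPeriodicPt S.F w.length ((sq, uq), q) from P.iterate_eq)]
  exact this _ (Nat.mod_lt _ P.length_pos)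

theorem isSaddle (P : S.IsExpandingPeriodic w σ τ q sq uq) (h0 : S.CondF0) :
    IsSaddle S.domain S.F ((sq, uq), q) 2 := by
  refine ⟨P.iterate_mem, w.length, P.length_pos, P.iterate_eq, ?_⟩
  obtain ⟨μ, hμ, hD⟩ := S.exists_derivIter_eq w P.s_mem P.u_mem (P.subset_Icc P.q_mem)
  rw [P.u_fix] at hD
  have ha := h0.abs_prod_a_lt P.ne_nil
  have hc := h0.one_lt_abs_prod_c P.ne_nil
  have hμ' := P.expanding μ hμ
  rw [hD, complexEigenvalues_diagMap]
  refine ⟨?_, ?_, by norm_num⟩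
  · intro z hz
    simp only [Multiset.insert_eq_cons, Multiset.mem_cons, Multiset.mem_singleton] at hz
    rcases hz with rfl | rfl | rfl <;> rw [Complex.norm_real, Real.norm_eq_abs]
    exacts [ha.ne, hc.ne', hμ'.ne']
  · rw [Multiset.insert_eq_cons, Multiset.countP_cons_of_neg, Multiset.insert_eq_cons,
      Multiset.countP_cons_of_pos, ← Multiset.cons_zero, Multiset.countP_cons_of_pos,
      Multiset.countP_zero]
    all_goals rw [Complex.norm_real, Real.norm_eq_abs]
    exacts [hμ', hc, ha.not_gt]

theorem segment_subset_stableManifold (P : S.IsExpandingPeriodic w σ τ q sq uq) (h0 : S.CondF0)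
    {s : ℝ} (hs : s ∈ Icc (0 : ℝ) 1) :
    ((s, uq), q) ∈ stableManifold S.domain S.F ((sq, uq), q) := by
  obtain ⟨p, hp, hpQ⟩ := exists_isPeriodicOrbitOf P.length_pos P.iterate_eq P.iterate_mem
  -- The orbits of the two points differ only in the first coordinate, which contracts.
  have key : ∀ n : ℕ, ∃ r ∈ Icc (0 : ℝ) 1, S.F^[n] ((s, uq), q) =
      ((r, (S.F^[n] ((sq, uq), q)).1.2), (S.F^[n] ((sq, uq), q)).2) ∧
      |r - (S.F^[n] ((sq, uq), q)).1.1| ≤ (S.df 0 1) ^ n * |s - sq| := by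
    intro n
    induction n with
    | zero => exact ⟨s, hs, rfl, by simp⟩
    | succ n ih =>
      obtain ⟨r, hr, e, hle⟩ := ih
      obtain ⟨i, hi1, hi2, hi3⟩ := S.mem_domain.1 (P.iterate_mem n)
      rw [Function.iterate_succ_apply', Function.iterate_succ_apply', e]
      set Z := S.F^[n] ((sq, uq), q)
      have hZ : S.F Z = _ := S.F_apply (x := Z.2) hi1 hi2
      rw [hZ, S.F_apply hr hi2]
      refine ⟨_, S.maps_s i hr, rfl, ?_⟩
      simp only
      rw [add_sub_add_right_eq_sub, ← mul_sub, abs_mul, pow_succ', mul_assoc]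
      exact mul_le_mul (h0.abs_a_le i) hle (abs_nonneg _) h0.2.2.2.1.le
  refine ⟨p, hp, fun n => S.F^[n] ((s, uq), q), rfl,
    fun n => ⟨?_, (Function.iterate_succ_apply' ..).symm⟩, 0, ?_⟩
  · obtain ⟨r, hr, e, -⟩ := key n
    obtain ⟨i, hi1, hi2, hi3⟩ := S.mem_domain.1 (P.iterate_mem n)
    simp only [e]
    exact S.mem_domain.2 ⟨i, hr, hi2, hi3⟩
  · refine squeeze_zero (fun _ => dist_nonneg) (fun n => ?_)
      (g := fun n => (S.df 0 1) ^ n * |s - sq|) ?_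
    · obtain ⟨r, hr, e, hle⟩ := key n
      simp only [hpQ (0 + n) n (by simp), e]
      rw [Prod.dist_eq, Prod.dist_eq, dist_self, dist_self,
        max_eq_left dist_nonneg, max_eq_left dist_nonneg, Real.dist_eq]
      exact hle
    · simpa using (tendsto_pow_atTop_nhds_zero_of_lt_one h0.2.2.2.1.le
        h0.2.2.2.2.1).mul_const |s - sq|

theorem disc_subset_unstableManifold (P : S.IsExpandingPeriodic w σ τ q sq uq) (h0 : S.CondF0)
    {u y : ℝ} (hu : u ∈ Icc (0 : ℝ) 1) (hy : y ∈ Icc σ τ) :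
    ((sq, u), y) ∈ unstableManifold S.domain S.F ((sq, uq), q) := by
  obtain ⟨Y, rfl, hYm, hYs, hYl⟩ := P.preimages y hy
  have hUm : ∀ k, (S.unstableBranch w)^[k] u ∈ Icc (0 : ℝ) 1 := fun k =>
    (S.mapsTo_unstableBranch w).iterate k hu
  have hword := fun k => S.iterate_F_of_word w P.s_mem (hUm k) (P.subset_Icc (hYm (k + 1)))
  refine mem_unstableManifold_of_tendsto P.length_pos S.continuousOn_F P.iterate_eq P.iterate_mem
    (Y := fun k => ((sq, (S.unstableBranch w)^[k] u), Y k)) (fun k j hj => ?_) (fun k => ?_) ?_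
  · simp only [Function.iterate_succ_apply']
    exact (hword k).2 j hj
  · simp only [Function.iterate_succ_apply']
    rw [(hword k).1, P.s_fix, hYs]
  · refine ((tendsto_const_nhds).prodMk_nhds ?_).prodMk_nhds hYl
    have hle : ∀ k, |(S.unstableBranch w)^[k] u - uq| ≤
        ((S.df 0 0)⁻¹ ^ w.length) ^ k * |u - uq| := by
      intro k
      induction k with
      | zero => simp
      | succ k ih =>
        have := S.abs_unstableBranch_sub_le h0.inv_abs_c_le w ((S.unstableBranch w)^[k] u) uq
        rw [P.u_fix] at this
        rw [Function.iterate_succ_apply', pow_succ', mul_assoc]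
        exact this.trans (mul_le_mul_of_nonneg_left ih (pow_nonneg h0.inv_df_zero_nonneg _))
    rw [tendsto_iff_dist_tendsto_zero]
    refine squeeze_zero (fun _ => dist_nonneg) hle ?_
    simpa using (tendsto_pow_atTop_nhds_zero_of_lt_one (pow_nonneg h0.inv_df_zero_nonneg _)
      (pow_lt_one₀ h0.inv_df_zero_nonneg (inv_lt_one_of_one_lt₀ h0.2.2.1)
        P.length_pos.ne')).mul_const |u - uq|

/-- The word `l` carries the unstable disc of the saddle over a neighbourhood of the point below,
and the word `r` carries this point back to the stable segment of the saddle. -/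
theorem mem_transverseIntersection (P : S.IsExpandingPeriodic w σ τ q sq uq) (h0 : S.CondF0)
    (l r : List (Fin 3)) {y : ℝ} (hy : y ∈ Icc σ τ)
    (hr : S.fibreWord r (S.fibreWord l y) = q) :
    ((S.stableWord l sq, S.unstableBranch r uq), S.fibreWord l y) ∈
      transverseIntersection (stableManifold S.domain S.F ((sq, uq), q))
        (unstableManifold S.domain S.F ((sq, uq), q)) := by
  have hstable : ∀ s ∈ Icc (0 : ℝ) 1, ((s, S.unstableBranch r uq), S.fibreWord l y) ∈
      stableManifold S.domain S.F ((sq, uq), q) := by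
    intro s hs
    have h := S.iterate_F_of_word r hs P.u_mem (S.mapsTo_fibreWord l (P.subset_Icc hy))
    refine mem_stableManifold_of_iterate h.2 ?_
    rw [h.1, hr]
    exact P.segment_subset_stableManifold h0 (S.mapsTo_stableWord r hs)
  have hunstable : ∀ u ∈ Icc (0 : ℝ) 1, ∀ x ∈ Icc σ τ, ((S.stableWord l sq, u), S.fibreWord l x) ∈
      unstableManifold S.domain S.F ((sq, uq), q) := by
    intro u hu x hx
    have h := S.iterate_F_of_word l P.s_mem hu (P.subset_Icc hx)
    rw [← h.1]
    exact iterate_mem_unstableManifold h.2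
      (P.disc_subset_unstableManifold h0 (S.mapsTo_unstableBranch l hu) hx)
  have hother : ∀ a : ℝ, ∃ b ∈ Icc (0 : ℝ) 1, b ≠ a := fun a => by
    by_cases ha : a = 0
    · exact ⟨1, right_mem_Icc.2 zero_le_one, by rw [ha]; exact one_ne_zero⟩
    · exact ⟨0, left_mem_Icc.2 zero_le_one, Ne.symm ha⟩
  have hs := S.mapsTo_stableWord l P.s_mem
  have hu := S.mapsTo_unstableBranch r P.u_mem
  obtain ⟨s', hs', hs'ne⟩ := hother (S.stableWord l sq)
  obtain ⟨u', hu', hu'ne⟩ := hother (S.unstableBranch r uq)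
  obtain ⟨y', hy', hy'ne⟩ : ∃ y' ∈ Icc σ τ, y' ≠ y := by
    by_cases h : y = σ
    · exact ⟨τ, right_mem_Icc.2 P.lt.le, by rw [h]; exact P.lt.ne'⟩
    · exact ⟨σ, left_mem_Icc.2 P.lt.le, Ne.symm h⟩
  refine mem_transverseIntersection_of_segments hs'ne hu'ne
    (x' := S.fibreWord l y') (fun h => hy'ne (S.injOn_fibreWord l (P.subset_Icc hy')
      (P.subset_Icc hy) h))
    (fun z hz => hstable z (ordConnected_Icc.uIcc_subset hs hs' hz))
    (fun z hz => hunstable z (ordConnected_Icc.uIcc_subset hu hu' hz) y hy) fun z hz => ?_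
  have hsub : uIcc y y' ⊆ Icc σ τ := ordConnected_Icc.uIcc_subset hy hy'
  obtain ⟨x, hx, rfl⟩ := intermediate_value_uIcc
    ((S.continuousOn_fibreWord l).mono (hsub.trans P.subset_Icc)) hz
  exact hunstable _ hu x (hsub hx)

end IsExpandingPeriodic

/-! ### The maximal invariant set -/

theorem isCompact_cube3 : IsCompact cube3 := by
  have : cube3 = (Icc (0 : ℝ) 1 ×ˢ Icc (0 : ℝ) 1) ×ˢ Icc (0 : ℝ) 1 := by
    ext z
    simp only [cube3, mem_ofPred_eq, mem_prod, and_assoc]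
  rw [this]
  exact (isCompact_Icc.prod isCompact_Icc).prod isCompact_Icc

theorem isClosed_Lam (S : HorseshoeSkewProduct) : IsClosed S.Lam :=
  isClosed_maximalInvariantSet S.continuousOn_F S.isClosed_domain isCompact_cube3

theorem mem_Lam_iff {X : Space3} : X ∈ S.Lam ↔
    (∀ n, ∃ Y ∈ cube3, (∀ j < n, S.F^[j] Y ∈ S.domain) ∧ S.F^[n] Y = X) ∧
      ∀ n, S.F^[n] X ∈ S.domain := by
  simp only [Lam, maximalInvariantSet, mem_inter_iff, mem_iInter, mem_iterate_fwdImage,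
    mem_iterate_bwdImage]
  refine and_congr_right fun _ => ⟨fun h n => (h (n + 1)).1 n n.lt_succ_self, fun h n =>
    ⟨fun j _ => h j, S.domain_subset_cube3 (h n)⟩⟩

theorem Lam_subset_domain : S.Lam ⊆ S.domain := fun _ hX => (mem_Lam_iff.1 hX).2 0

theorem mapsTo_F_Lam : MapsTo S.F S.Lam S.Lam := by
  intro X hX
  obtain ⟨h1, h2⟩ := mem_Lam_iff.1 hX
  refine mem_Lam_iff.2 ⟨fun n => ?_, fun n => h2 (n + 1)⟩
  cases n with
  | zero => exact ⟨S.F X, S.mapsTo_F_cube3 (h2 0), by simp, rfl⟩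
  | succ n =>
    obtain ⟨Y, hY, hj, rfl⟩ := h1 n
    refine ⟨Y, hY, fun j hjn => ?_, Function.iterate_succ_apply' ..⟩
    rcases Nat.lt_succ_iff_lt_or_eq.1 hjn with h | rfl
    exacts [hj j h, h2 0]

theorem relHomoclinicClass_subset_Lam (Q : Space3) :
    relHomoclinicClass S.domain S.F cube3 Q ⊆ S.Lam := by
  refine closure_minimal ?_ S.isClosed_Lam
  rintro X ⟨-, x, hx, rfl, hC⟩
  exact hx.mem_maximalInvariantSet hC

/-- Near a point of the maximal invariant set there is a box of points determined by a finite past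
`v`, a finite future `v'`, and an interval of initial positions in the fibre. -/
theorem exists_words_near (h0 : S.CondF0) {X : Space3} (hX : X ∈ S.Lam) {ε : ℝ} (hε : 0 < ε) :
    ∃ v v' α β, 0 < α ∧ α < β ∧ β < 1 ∧ ∀ s ∈ Icc (0 : ℝ) 1, ∀ u ∈ Icc (0 : ℝ) 1,
      ∀ x ∈ Icc α β,
        dist ((S.stableWord v s, S.unstableBranch v' u), S.fibreWord v x) X < ε := by
  obtain ⟨h1, h2⟩ := mem_Lam_iff.1 hX
  obtain ⟨n, hn⟩ := exists_pow_lt_of_lt_one hε h0.2.2.2.2.1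
  obtain ⟨k, hk⟩ := exists_pow_lt_of_lt_one hε (inv_lt_one_of_one_lt₀ h0.2.2.1)
  have hXC : X ∈ cube3 := S.domain_subset_cube3 (h2 0)
  obtain ⟨v', hv'l, hv'u, -, -⟩ := S.exists_word_of_iterate k hXC fun j _ => h2 j
  have hXk := S.domain_subset_cube3 (h2 k)
  obtain ⟨Y, hY, hYj, rfl⟩ := h1 n
  obtain ⟨v, hvl, -, hvs, hvx⟩ := S.exists_word_of_iterate n hY hYj
  set X := S.F^[n] Y
  have habs : ∀ {a b : ℝ}, a ∈ Icc (0 : ℝ) 1 → b ∈ Icc (0 : ℝ) 1 → |a - b| ≤ 1 := fun ha hb =>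
    abs_le.2 ⟨by linarith [ha.1, hb.2], by linarith [ha.2, hb.1]⟩
  obtain ⟨δ, hδ, hball⟩ := Metric.continuousWithinAt_iff.1
    (S.continuousOn_fibreWord v Y.2 hY.2.2) ε hε
  -- An interval of `(0,1)` close to the fibre coordinate of `Y`, which may be `0` or `1`.
  obtain ⟨α, β, hα, hαβ, hβ, hnear⟩ : ∃ α β : ℝ, 0 < α ∧ α < β ∧ β < 1 ∧
      ∀ x ∈ Icc α β, |x - Y.2| < δ := by
    obtain ⟨hy0, hy1⟩ := hY.2.2
    have hlt : max 0 (Y.2 - δ) < min 1 (Y.2 + δ) :=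
      max_lt (lt_min one_pos (by linarith)) (lt_min (by linarith) (by linarith))
    obtain ⟨α, ha1, ha2⟩ := exists_between hlt
    obtain ⟨β, hb1, hb2⟩ := exists_between ha2
    refine ⟨α, β, (le_max_left _ _).trans_lt ha1, hb1, hb2.trans_le (min_le_left _ _),
      fun x hx => abs_lt.2 ⟨?_, ?_⟩⟩
    · linarith [(le_max_right 0 (Y.2 - δ)).trans_lt ha1, hx.1]
    · linarith [hb2.trans_le (min_le_right 1 (Y.2 + δ)), hx.2]
  refine ⟨v, v', α, β, hα, hαβ, hβ, fun s hs u hu x hx => ?_⟩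
  rw [Prod.dist_eq, Prod.dist_eq]
  refine max_lt (max_lt ?_ ?_) ?_
  · simp only
    rw [hvs, Real.dist_eq]
    refine (S.abs_stableWord_sub_le h0.abs_a_le v s Y.1.1).trans_lt ?_
    rw [hvl]
    exact (mul_le_of_le_one_right (pow_nonneg h0.2.2.2.1.le _) (habs hs hY.1)).trans_lt hn
  · simp only
    rw [hv'u, Real.dist_eq]
    refine (S.abs_unstableBranch_sub_le h0.inv_abs_c_le v' u _).trans_lt ?_
    rw [hv'l]
    exact (mul_le_of_le_one_right (pow_nonneg h0.inv_df_zero_nonneg _)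
      (habs hu hXk.2.1)).trans_lt hk
  · simp only
    rw [hvx]
    exact hball ⟨(hα.trans_le hx.1).le, (hx.2.trans_lt hβ).le⟩ (hnear x hx)

namespace IsExpandingPeriodic

variable {w : List (Fin 3)} {σ τ q sq uq : ℝ}

theorem mem_homoclinic (P : S.IsExpandingPeriodic w σ τ q sq uq) (h0 : S.CondF0)
    (l r : List (Fin 3)) {y : ℝ} (hy : y ∈ Icc σ τ)
    (hr : S.fibreWord r (S.fibreWord l y) = q) :
    ((S.stableWord l sq, S.unstableBranch r uq), S.fibreWord l y) ∈
      {X | X ∈ transverseIntersection (stableManifold S.domain S.F ((sq, uq), q))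
        (unstableManifold S.domain S.F ((sq, uq), q)) ∧
        ∃ x : ℤ → Space3, IsFullOrbit S.domain S.F x ∧ x 0 = X ∧ ∀ n : ℤ, x n ∈ cube3} := by
  have h := P.mem_transverseIntersection h0 l r hy hr
  obtain ⟨x, hx, hx0⟩ := exists_isFullOrbit h.1 h.2.1
  exact ⟨h, x, hx, hx0, fun n => S.domain_subset_cube3 (hx n).1⟩

theorem Lam_eq_relHomoclinicClass (P : S.IsExpandingPeriodic w σ τ q sq uq) (h0 : S.CondF0)
    (hcov : S.CoveringProperty) :
    S.Lam = relHomoclinicClass S.domain S.F cube3 ((sq, uq), q) := by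
  refine Subset.antisymm (fun X hX => ?_) (relHomoclinicClass_subset_Lam _)
  refine Metric.mem_closure_iff.2 fun ε hε => ?_
  obtain ⟨v, v', α, β, hα, hαβ, hβ, hnear⟩ := exists_words_near h0 hX hε
  -- The itinerary is: the past of the saddle, `w₁`, `v`, `v'`, `w₂`, the future of the saddle.
  obtain ⟨w₁, hw₁⟩ := hcov σ τ α β P.pos P.lt P.lt_one hα hαβ.le hβ
  obtain ⟨w₂, hw₂⟩ := hcov.exists_append (v ++ v') hα hαβ hβ P.pos P.lt.le P.lt_one
  obtain ⟨x, hx, hxq⟩ := hw₂ P.q_mem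
  obtain ⟨y, hy, rfl⟩ := hw₁ hx
  have hm := P.mem_homoclinic h0 (w₁ ++ v) (v' ++ w₂) hy (by
    rw [← hxq]
    simp only [fibreWord_append])
  refine ⟨_, hm, ?_⟩
  rw [dist_comm, stableWord_append, unstableBranch_append, fibreWord_append]
  exact hnear _ (S.mapsTo_stableWord _ P.s_mem) _ (S.mapsTo_unstableBranch _ P.u_mem) _ hx

theorem isTopologicallyTransitive_Lam (P : S.IsExpandingPeriodic w σ τ q sq uq) (h0 : S.CondF0)
    (hcov : S.CoveringProperty) : IsTopologicallyTransitive S.F S.Lam := by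
  have hLam : ∀ l r {y : ℝ}, y ∈ Icc σ τ → S.fibreWord r (S.fibreWord l y) = q →
      ((S.stableWord l sq, S.unstableBranch r uq), S.fibreWord l y) ∈ S.Lam :=
    fun l r y hy hr => relHomoclinicClass_subset_Lam ((sq, uq), q)
      (subset_closure (P.mem_homoclinic h0 l r hy hr))
  refine isTopologicallyTransitive_of_exists_dist_lt S.isClosed_Lam
    ⟨_, hLam [] [] P.q_mem rfl⟩ (S.continuousOn_F.mono Lam_subset_domain) mapsTo_F_Lam
    fun X hX X' hX' ε hε => ?_
  obtain ⟨v, v', α, β, hα, hαβ, hβ, hnear⟩ := exists_words_near h0 hX hε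
  obtain ⟨z, z', α', β', hα', hαβ', hβ', hnear'⟩ := exists_words_near h0 hX' hε
  -- The itinerary is: the past of the saddle, `w₁`, `v`, `v'`, `w₂`, `z`, `z'`, `w₃`, the future of
  -- the saddle. The orbit is close to `X` after `v` and close to `X'` after `z`.
  obtain ⟨w₁, hw₁⟩ := hcov σ τ α β P.pos P.lt P.lt_one hα hαβ.le hβ
  obtain ⟨w₂, hw₂⟩ := hcov.exists_append (v ++ v') hα hαβ hβ hα' hαβ'.le hβ'
  obtain ⟨w₃, hw₃⟩ := hcov.exists_append (z ++ z') hα' hαβ' hβ' P.pos P.lt.le P.lt_one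
  obtain ⟨x', hx', hx'q⟩ := hw₃ P.q_mem
  obtain ⟨x, hx, rfl⟩ := hw₂ hx'
  obtain ⟨y, hy, rfl⟩ := hw₁ hx
  have hm := hLam (w₁ ++ v) (v' ++ (w₂ ++ (z ++ (z' ++ w₃)))) hy (by
    rw [← hx'q]
    simp only [fibreWord_append])
  refine ⟨_, hm, (v' ++ (w₂ ++ z)).length, ?_, ?_⟩
  · rw [stableWord_append, unstableBranch_append, fibreWord_append]
    exact hnear _ (S.mapsTo_stableWord _ P.s_mem) _ (S.mapsTo_unstableBranch _ P.u_mem) _ hx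
  · have hx01 := S.mapsTo_fibreWord (w₁ ++ v) (P.subset_Icc hy)
    have h := (S.iterate_F_of_word (v' ++ (w₂ ++ z)) (S.mapsTo_stableWord (w₁ ++ v) P.s_mem)
      (S.mapsTo_unstableBranch (z' ++ w₃) P.u_mem) hx01).1
    rw [← unstableBranch_append] at h
    simp only [List.append_assoc] at h ⊢
    rw [h]
    simp only [fibreWord_append, stableWord_append, unstableBranch_append] at hx' ⊢
    exact hnear' _ (S.mapsTo_stableWord w₂ (S.mapsTo_stableWord v' (S.mapsTo_stableWord v
      (S.mapsTo_stableWord w₁ P.s_mem)))) _ (S.mapsTo_unstableBranch _ P.u_mem) _ hx'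

end IsExpandingPeriodic

end HorseshoeSkewProduct

theorem mainTheorem4 (S : HorseshoeSkewProduct) (γ : ℝ) (h0 : S.CondF0) (h1 : S.CondF1 γ)
    (h2 : S.CondF2) (h01 : S.CondF01 γ) :
    (∃ Q : Space3, IsSaddle S.domain S.F Q 2 ∧
      S.Lam = relHomoclinicClass S.domain S.F cube3 Q) ∧
    IsTopologicallyTransitive S.F S.Lam := by
  obtain ⟨hcov, w, σ, τ, q, sq, uq, P⟩ :=
    HorseshoeSkewProduct.exists_isExpandingPeriodic h0 h1 h01
  exact ⟨⟨_, P.isSaddle h0, P.Lam_eq_relHomoclinicClass h0 hcov⟩,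
    P.isTopologicallyTransitive_Lam h0 hcov⟩
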